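/- Let $\mathcal X,\mathcal Y$ be finite sets and let $W$ be a discrete memoryless channel, i.e. a stochastic matrix $W(y|x)$, $x\in\mathcal X$, $y\in\mathcal Y$. Logarithms are natural. $W$ is *singular* if $W(y|x)=W(y|z)$ for all $x,z\in\mathcal X$ and $y\in\mathcal Y$ with $W(y|x)W(y|z)>0$. $W$ is *symmetric* (in Gallager's sense) if $\mathcal Y$ can be partitioned into subsets such that, in the submatrix of transition probabilities corresponding to each subset, every row is a permutation of every other row and every column is a permutation of every other column. For a probability distribution $P$ on $\mathcal X$ let $q_P(y)=\sum_x P(x)W(y|x)$, let $$I(P;W)=\sum_{x,y}P(x)W(y|x)\ln\frac{W(y|x)}{q_P(y)},$$ let $C(W)=\max_P I(P;W)$ be the capacity, and let $$V(P,W)=\sum_{x,y}P(x)W(y|x)\left[\ln\frac{W(y|x)}{q_P(y)}-\sum_b W(b|x)\ln\frac{W(b|x)}{q_P(b)}\right]^2 .$$ For $\varepsilon\in(0,1)$ let $V_\varepsilon(W)$ be the minimum (if $\varepsilon<1/2$) or the maximum (if $\varepsilon\ge 1/2$) of $V(Q,W)$ over all distributions $Q$ with $I(Q;W)=C(W)$.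 Let $\Phi$ be the standard normal distribution function. For an integer $n\ge 1$ and $R\in\mathbb R$, an $(n,R)$ code consists of an encoder $\{1,\dots,M\}\to\mathcal X^n$ and a decoder $\mathcal Y^n\to\{1,\dots,M\}$ with $M=\lceil e^{nR}\rceil$. Let $\bar P_e(n,R)$ be the minimum over all $(n,R)$ codes of the average error probability, for equiprobable messages and $n$ independent uses of $W$, and let $M^*(n,\varepsilon)=\max\{\lceil e^{nR}\rceil:\bar P_e(n,R)\le\varepsilon\}$. **Proposition.** Let $\varepsilon\in(0,1)$ and let $W$ be singular and symmetric with $V_\varepsilon(W)>0$. Then there is a constant $K=K(\varepsilon,W)>0$, depending only on $\varepsilon$ and $W$, such that for every $n\ge 1$ the maximum defining $M^*(n,\varepsilon)$ is attained and $$\ln M^*(n,\varepsilon)\le nC(W)+\sqrt{nV_\varepsilon(W)}\,\Phi^{-1}(\varepsilon)+K(\varepsilon,W).$$ -/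

import Mathlib

noncomputable section

namespace DMC

/-- A discrete memoryless channel, that is, a stochastic matrix from the finite input alphabet `X`
to the finite output alphabet `Y`: `prob x y` is `W(y|x)`. -/
structure Channel (X Y : Type*) [Fintype Y] where
  prob : X → Y → ℝ
  nonneg : ∀ x y, 0 ≤ prob x y
  sum_eq_one : ∀ x, ∑ y, prob x y = 1

namespace Channel

variable {X Y : Type*} [Fintype X] [Fintype Y]

/-- Symmetry in the sense of Gallager: the outputs can be partitioned into subsets such that, in the
submatrix of transition probabilities given by each subset, the rows are permutations of each other
and the columns are permutations of each other. -/
def IsSymmetric (W : Channel X Y) : Prop :=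
  ∃ parts : Set (Set Y), Setoid.IsPartition parts ∧ ∀ S ∈ parts,
    (∀ x x' : X, ∃ σ : Equiv.Perm S, ∀ y : S, W.prob x' y = W.prob x (σ y)) ∧
    (∀ y ∈ S, ∀ y' ∈ S, ∃ τ : Equiv.Perm X, ∀ x : X, W.prob x y' = W.prob (τ x) y)

/-- A channel is singular if all positive entries of each column are equal. -/
def IsSingular (W : Channel X Y) : Prop :=
  ∀ (x : X) (y : Y) (z : X), 0 < W.prob x y * W.prob z y → W.prob x y = W.prob z y

/-- The output distribution `q_P` induced by the input distribution `P`. -/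
def outputDist (W : Channel X Y) (P : X → ℝ) (y : Y) : ℝ :=
  ∑ x, P x * W.prob x y

/-- The mutual information `I(P;W)`, in nats. Terms with `P x * W.prob x y = 0` vanish. -/
def mutualInfo (W : Channel X Y) (P : X → ℝ) : ℝ :=
  ∑ x, ∑ y, P x * W.prob x y * Real.log (W.prob x y / W.outputDist P y)

/-- The capacity `C(W)`, the maximum of `I(P;W)` over all input distributions `P`. -/
def capacity (W : Channel X Y) : ℝ :=
  sSup (W.mutualInfo '' stdSimplex ℝ X)

/-- `V(P,W)`, the conditional variance of the information density. -/
def condVariance (W : Channel X Y) (P : X → ℝ) : ℝ :=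
  ∑ x, ∑ y, P x * W.prob x y *
    (Real.log (W.prob x y / W.outputDist P y) -
      ∑ b, W.prob x b * Real.log (W.prob x b / W.outputDist P b)) ^ 2

/-- The set of capacity-achieving input distributions. -/
def capacityAchieving (W : Channel X Y) : Set (X → ℝ) :=
  {Q | Q ∈ stdSimplex ℝ X ∧ W.mutualInfo Q = W.capacity}

/-- The `ε`-dispersion `V_ε(W)`: the minimum (if `ε < 1/2`) or the maximum (if `1/2 ≤ ε`) of
`V(Q,W)` over all capacity-achieving `Q`. -/
def dispersion (W : Channel X Y) (ε : ℝ) : ℝ :=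
  if ε < 1 / 2 then sInf (W.condVariance '' W.capacityAchieving)
  else sSup (W.condVariance '' W.capacityAchieving)

/-- The probability `W(yⁿ|xⁿ)` of the output word `y` for the input word `x`, over `n`
independent uses of the channel. -/
def blockProb (W : Channel X Y) {n : ℕ} (x : Fin n → X) (y : Fin n → Y) : ℝ :=
  ∏ i, W.prob (x i) (y i)

end Channel

/-- A block code of length `n` with `M` messages. -/
structure Code (X Y : Type*) (n M : ℕ) where
  encoder : Fin M → (Fin n → X)
  decoder : (Fin n → Y) → Fin M

namespace Channel

variable {X Y : Type*} [Fintype X] [Fintype Y]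

open Classical in
/-- The average error probability of a code over `W`, the messages being equiprobable. -/
def avgError (W : Channel X Y) {n M : ℕ} (c : Code X Y n M) : ℝ :=
  (1 / (M : ℝ)) * ∑ m : Fin M, ∑ y : Fin n → Y,
    if c.decoder y ≠ m then W.blockProb (c.encoder m) y else 0

/-- The minimum average error probability of an `(n,R)` code, that is, of a code of length `n` with
`⌈exp (n R)⌉` messages. (There are finitely many such codes.) -/
def minAvgError (W : Channel X Y) (n : ℕ) (R : ℝ) : ℝ :=
  ⨅ c : Code X Y n ⌈Real.exp (n * R)⌉₊, W.avgError c

/-- The numbers of messages `⌈exp (n R)⌉` for which the minimum average error probability is at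
most `ε`. -/
def achievableSizes (W : Channel X Y) (n : ℕ) (ε : ℝ) : Set ℕ :=
  {M | ∃ R : ℝ, M = ⌈Real.exp (n * R)⌉₊ ∧ W.minAvgError n R ≤ ε}

/-- `M*(n,ε)`, the largest achievable number of messages. -/
def maxSize (W : Channel X Y) (n : ℕ) (ε : ℝ) : ℕ :=
  sSup (W.achievableSizes n ε)

end Channel

/-- The distribution function `Φ` of the standard normal distribution. -/
def stdNormalCDF (x : ℝ) : ℝ :=
  ProbabilityTheory.cdf (ProbabilityTheory.gaussianReal 0 1) x

/-- The quantile function `Φ⁻¹` of the standard normal distribution, on `(0,1)`. -/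
def stdNormalQuantile (ε : ℝ) : ℝ :=
  sInf {t : ℝ | ε ≤ stdNormalCDF t}

end DMC

end

/-! In a singular channel the information density under the uniform input depends on the output
alone: it is `density y = log (|X| / degree y)`, and `W(y|x) ≤ q(y) exp (density y)` for the uniform
output law `q`, with equality wherever `W(y|x) > 0`. Symmetry makes the law of this density the same
under every row of `W`, hence also under `q`; for words, the sum `z(y)` of the densities has the
same law under every codeword and under `qⁿ` (`IsSymmetric.sum_blockProb_mul`).

For a code with `M` messages, comparing likelihoods output by output on the event `z < log M` bounds
the error probability below by the `qⁿ`-mean of `max 0 (1 - exp (z - log M))`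
(`sum_uniformOutput_le_avgError`). No auxiliary threshold has to be optimized, and this is why no
`log n` term appears. Since `max 0 (1 - exp (z - a))` is the probability that `z + T ≤ a` for a
standard exponential `T`, Berry–Esseen shows that this mean differs from the normal approximation by
`O(1/√n)` (`exists_stdNormalCDF_le_sum_exp` is the side needed). Hence `Φ((log M - nC)/√(nV)) ≤ ε +
K/√n`. Inverting `Φ` near its quantile moves the argument by `O(1/√n)`, so `log M` by `O(1)`; the
finitely many small `n` are covered by a crude bound.

The mean and variance of `density` are the capacity and the dispersion, because `I(P;W)` equals the
mean minus the relative entropy of `q_P` with respect to `q`. Berry–Esseen itself follows from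
Esseen smoothing with a Fejér kernel and a Taylor estimate of characteristic functions. -/

namespace DMC

/-! ### Esseen's smoothing inequality -/

section Smoothing

open MeasureTheory ProbabilityTheory Filter Set
open scoped Topology

/-- The Fejér kernel of bandwidth `δ`, up to normalization. -/
noncomputable def fejer (δ u : ℝ) : ℝ := ∫ t in (0 : ℝ)..δ, (1 - t / δ) * Real.cos (t * u)

lemma fejer_eq {δ u : ℝ} (hδ : 0 < δ) (hu : u ≠ 0) :
    fejer δ u = (1 - Real.cos (δ * u)) / (δ * u ^ 2) := by
  have h : ∀ t ∈ uIcc (0 : ℝ) δ, HasDerivAt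
      (fun t => (1 - t / δ) * (Real.sin (t * u) / u) - Real.cos (t * u) / (δ * u ^ 2))
      ((1 - t / δ) * Real.cos (t * u)) t := by
    intro t _
    have h1 : HasDerivAt (fun t : ℝ => t * u) u t := by simpa using (hasDerivAt_id t).mul_const u
    have h2 : HasDerivAt (fun t : ℝ => 1 - t / δ) (-(1 / δ)) t := by
      simpa using ((hasDerivAt_id t).div_const δ).const_sub 1
    have h3 := (h2.mul (h1.sin.div_const u)).sub (h1.cos.div_const (δ * u ^ 2))
    refine h3.congr_deriv ?_
    field_simp
    ring
  rw [fejer, intervalIntegral.integral_eq_sub_of_hasDerivAt h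
    (Continuous.intervalIntegrable (by fun_prop) _ _)]
  field_simp
  simp
  ring

lemma fejer_zero {δ : ℝ} (hδ : 0 < δ) : fejer δ 0 = δ / 2 := by
  have h : ∀ t ∈ uIcc (0 : ℝ) δ, HasDerivAt (fun t => t - t ^ 2 / (2 * δ)) (1 - t / δ) t := by
    intro t _
    refine ((hasDerivAt_id t).sub ((hasDerivAt_pow 2 t).div_const (2 * δ))).congr_deriv ?_
    field_simp
    norm_num
    ring
  simp only [fejer, mul_zero, Real.cos_zero, mul_one]
  rw [intervalIntegral.integral_eq_sub_of_hasDerivAt h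
    (Continuous.intervalIntegrable (by fun_prop) _ _)]
  field_simp
  ring

lemma fejer_neg (δ u : ℝ) : fejer δ (-u) = fejer δ u := by simp [fejer]

lemma fejer_nonneg {δ : ℝ} (hδ : 0 < δ) (u : ℝ) : 0 ≤ fejer δ u := by
  rcases eq_or_ne u 0 with rfl | hu
  · rw [fejer_zero hδ]; positivity
  · rw [fejer_eq hδ hu]
    have := Real.cos_le_one (δ * u)
    exact div_nonneg (by linarith) (by positivity)

lemma continuous_fejer (δ : ℝ) : Continuous (fejer δ) := by
  unfold fejer
  exact intervalIntegral.continuous_parametric_intervalIntegral_of_continuous' (by fun_prop) _ _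

lemma integrable_fejer {δ : ℝ} (hδ : 0 < δ) : Integrable (fejer δ) := by
  have hd : Integrable (fun u : ℝ => (2 * δ + 4 / δ) * (1 + u ^ 2)⁻¹) :=
    integrable_inv_one_add_sq.const_mul _
  refine hd.mono' (continuous_fejer δ).aestronglyMeasurable (ae_of_all _ fun u => ?_)
  rw [Real.norm_of_nonneg (fejer_nonneg hδ u), ← div_eq_mul_inv, le_div_iff₀ (by positivity)]
  -- Boundedness near the origin and decay like `1/u²` at infinity together give the domination.
  have h1 : fejer δ u ≤ δ := by
    have := intervalIntegral.norm_integral_le_of_norm_le_const (a := 0) (b := δ) (C := 1)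
      (f := fun t => (1 - t / δ) * Real.cos (t * u)) (by
        intro t ht
        rw [uIoc_of_le hδ.le] at ht
        have h0 : t / δ ≤ 1 := (div_le_one hδ).2 ht.2
        have h0' : 0 < t / δ := div_pos ht.1 hδ
        rw [norm_mul, Real.norm_eq_abs, Real.norm_eq_abs, abs_of_nonneg (by linarith)]
        nlinarith [Real.abs_cos_le_one (t * u), abs_nonneg (Real.cos (t * u))])
    rw [sub_zero, abs_of_pos hδ, one_mul, Real.norm_eq_abs] at this
    exact (le_abs_self _).trans this
  have h2 : fejer δ u * u ^ 2 ≤ 2 / δ := by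
    rcases eq_or_ne u 0 with rfl | hu
    · simp; positivity
    · rw [fejer_eq hδ hu]
      have := Real.neg_one_le_cos (δ * u)
      rw [show (1 - Real.cos (δ * u)) / (δ * u ^ 2) * u ^ 2 = (1 - Real.cos (δ * u)) / δ by
        field_simp]
      gcongr; linarith
  have h3 : 2 / δ ≤ 4 / δ := by gcongr; norm_num
  nlinarith

lemma integral_fejer_pos {δ : ℝ} (hδ : 0 < δ) : 0 < ∫ u, fejer δ u :=
  integral_pos_of_integrable_nonneg_nonzero (x := 0) (continuous_fejer δ) (integrable_fejer hδ)
    (fejer_nonneg hδ) (by rw [fejer_zero hδ]; positivity)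

lemma integral_complex_re {α : Type*} [MeasurableSpace α] {μ : Measure α} {f : α → ℂ}
    (hf : Integrable f μ) : ∫ x, (f x).re ∂μ = (∫ x, f x ∂μ).re :=
  integral_re hf

/-- Fubini, with the cosine read as the real part of an exponential. The smoothed measure thus sees
the characteristic function only on `[0, δ]`. -/
lemma integral_fejer_sub (μ : Measure ℝ) [IsProbabilityMeasure μ] {δ : ℝ} (hδ : 0 < δ) (v : ℝ) :
    ∫ x, fejer δ (v - x) ∂μ = (∫ t in (0 : ℝ)..δ,
      ((1 - t / δ : ℝ) : ℂ) * Complex.exp (-(t * v * Complex.I)) * charFun μ t).re := by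
  have hint : Integrable (Function.uncurry fun (x t : ℝ) =>
      ((1 - t / δ : ℝ) : ℂ) * Complex.exp (-(t * v * Complex.I)) * Complex.exp (t * x * Complex.I))
      (μ.prod (volume.restrict (Ioc 0 δ))) := by
    refine Integrable.of_bound (C := 1)
      (Continuous.aestronglyMeasurable (by unfold Function.uncurry; fun_prop)) ?_
    have : ∀ᵐ p : ℝ × ℝ ∂(μ.prod (volume.restrict (Ioc 0 δ))), p.2 ∈ Ioc 0 δ :=
      Measure.quasiMeasurePreserving_snd.ae (ae_restrict_mem measurableSet_Ioc)
    filter_upwards [this] with p hp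
    have e1 : ‖Complex.exp (-(p.2 * v * Complex.I))‖ = 1 := by
      have := Complex.norm_exp_ofReal_mul_I (-(p.2 * v))
      push_cast at this
      rwa [neg_mul] at this
    have e2 : ‖Complex.exp (p.2 * p.1 * Complex.I)‖ = 1 := by
      have := Complex.norm_exp_ofReal_mul_I (p.2 * p.1)
      push_cast at this
      exact this
    have h0 : p.2 / δ ≤ 1 := (div_le_one hδ).2 hp.2
    have h0' : 0 < p.2 / δ := div_pos hp.1 hδ
    simp only [Function.uncurry, norm_mul, e1, e2, mul_one, Complex.norm_real, Real.norm_eq_abs]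
    rw [abs_of_nonneg (by linarith)]
    linarith
  have key : ∀ x : ℝ, fejer δ (v - x) = (∫ t in (0 : ℝ)..δ, ((1 - t / δ : ℝ) : ℂ) *
      Complex.exp (-(t * v * Complex.I)) * Complex.exp (t * x * Complex.I)).re := by
    intro x
    rw [← Complex.reCLM_apply, ← Complex.reCLM.intervalIntegral_comp_comm
      (Continuous.intervalIntegrable (by fun_prop) _ _)]
    refine intervalIntegral.integral_congr fun t _ => ?_
    simp only [Complex.reCLM_apply]
    rw [mul_assoc, ← Complex.exp_add, Complex.re_ofReal_mul,
      show -(t * v * Complex.I) + t * x * Complex.I = ((-(t * (v - x)) : ℝ) : ℂ) * Complex.I by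
        push_cast; ring, Complex.exp_ofReal_mul_I_re, Real.cos_neg]
  simp_rw [key, intervalIntegral.integral_of_le hδ.le]
  have hi := hint.integral_prod_left
  simp only [Function.uncurry] at hi
  rw [integral_complex_re hi, integral_integral_swap hint]
  congr 2 with t
  rw [integral_const_mul, charFun_apply_real]

/-- Integrating `exp (-itv)` over `v` first produces a factor of modulus at most `2/t`, whatever the
endpoints. The factor `t` in the assumed bound `t * b t` cancels this singularity at `0`. -/
lemma abs_integral_fejer_diff_le (μ ν : Measure ℝ) [IsProbabilityMeasure μ]
    [IsProbabilityMeasure ν] {δ : ℝ} (hδ : 0 < δ) {b : ℝ → ℝ} (hb : Continuous b)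
    (hφ : ∀ t ∈ Ioc 0 δ, ‖charFun μ t - charFun ν t‖ ≤ t * b t) {a₀ a : ℝ} (ha : a₀ ≤ a) :
    |∫ v in a₀..a, (∫ x, fejer δ (v - x) ∂μ - ∫ x, fejer δ (v - x) ∂ν)| ≤
      2 * ∫ t in (0 : ℝ)..δ, b t := by
  set ψ : ℝ → ℂ := fun t => charFun μ t - charFun ν t with hψ
  have hμc : Continuous (charFun μ) := continuous_charFun
  have hνc : Continuous (charFun ν) := continuous_charFun
  have hψc : Continuous ψ := hμc.sub hνc
  set g : ℝ → ℝ → ℂ := fun v t =>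
    ((1 - t / δ : ℝ) : ℂ) * Complex.exp (-(t * v * Complex.I)) * ψ t with hg
  have hgc : Continuous (Function.uncurry g) := by
    simp only [hg, Function.uncurry_def]; fun_prop
  have h1 : ∀ v, ∫ x, fejer δ (v - x) ∂μ - ∫ x, fejer δ (v - x) ∂ν =
      (∫ t in (0 : ℝ)..δ, g v t).re := by
    intro v
    rw [integral_fejer_sub μ hδ, integral_fejer_sub ν hδ, ← Complex.sub_re,
      ← intervalIntegral.integral_sub (Continuous.intervalIntegrable (by fun_prop) _ _)
        (Continuous.intervalIntegrable (by fun_prop) _ _)]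
    simp only [hg, hψ, mul_sub]
  have hgi : Integrable (Function.uncurry g)
      ((volume.restrict (Ioc a₀ a)).prod (volume.restrict (Ioc 0 δ))) := by
    rw [Measure.prod_restrict]
    exact (hgc.continuousOn.integrableOn_compact (isCompact_Icc.prod isCompact_Icc)).mono_set
      (prod_mono Ioc_subset_Icc_self Ioc_subset_Icc_self)
  have hgl := hgi.integral_prod_left
  simp only [Function.uncurry] at hgl
  simp_rw [h1, intervalIntegral.integral_of_le hδ.le, intervalIntegral.integral_of_le ha]
  rw [integral_complex_re hgl, integral_integral_swap hgi]
  refine (Complex.abs_re_le_norm _).trans ?_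
  rw [← integral_const_mul]
  refine norm_integral_le_of_norm_le ((hb.const_mul 2).integrableOn_Ioc) ?_
  filter_upwards [ae_restrict_mem measurableSet_Ioc] with t ht
  have ht0 : (t : ℂ) ≠ 0 := by exact_mod_cast ht.1.ne'
  have hc : -(t * Complex.I) ≠ 0 := by simp [ht0]
  have h2 : ∫ v in Ioc a₀ a, g v t = ((1 - t / δ : ℝ) : ℂ) *
      ((Complex.exp (-(t * Complex.I) * a) - Complex.exp (-(t * Complex.I) * a₀)) /
        -(t * Complex.I)) * ψ t := by
    simp only [hg]
    rw [integral_mul_const, integral_const_mul, ← integral_exp_mul_complex hc,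
      intervalIntegral.integral_of_le ha]
    congr 3 with v
    ring_nf
  have e : ∀ v : ℝ, ‖Complex.exp (-(t * Complex.I) * v)‖ = 1 := by
    intro v
    have := Complex.norm_exp_ofReal_mul_I (-(t * v))
    push_cast at this
    rw [← this]; ring_nf
  have h3 : ‖Complex.exp (-(t * Complex.I) * a) - Complex.exp (-(t * Complex.I) * a₀)‖ ≤ 2 :=
    (norm_sub_le _ _).trans (by rw [e, e]; norm_num)
  have h4 : ‖((1 - t / δ : ℝ) : ℂ)‖ ≤ 1 := by
    have h0 : t / δ ≤ 1 := (div_le_one hδ).2 ht.2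
    have h0' : 0 < t / δ := div_pos ht.1 hδ
    rw [Complex.norm_real, Real.norm_eq_abs, abs_of_nonneg (by linarith)]
    linarith
  have h5 : ‖-(t * Complex.I)‖ = t := by simp [abs_of_pos ht.1]
  rw [h2, norm_mul, norm_mul, norm_div, h5]
  calc _ ≤ 1 * (2 / t) * (t * b t) := by
        have := hφ t ht
        have := ht.1
        gcongr
    _ = 2 * b t := by have := ht.1.ne'; field_simp

lemma integrable_fejer_sub (μ : Measure ℝ) [IsProbabilityMeasure μ] {δ : ℝ} (hδ : 0 < δ) :
    Integrable (Function.uncurry fun v x => fejer δ (v - x)) (volume.prod μ) := by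
  have hc := continuous_fejer δ
  rw [integrable_prod_iff' (Continuous.aestronglyMeasurable
    (by simp only [Function.uncurry_def]; fun_prop))]
  refine ⟨ae_of_all _ fun x => (integrable_fejer hδ).comp_sub_right x, ?_⟩
  simp only [Function.uncurry]
  have : ∀ x, ∫ v, ‖fejer δ (v - x)‖ = ∫ v, ‖fejer δ v‖ := fun x =>
    integral_sub_right_eq_self (fun v => ‖fejer δ v‖) x
  simp_rw [this]
  exact integrable_const _

lemma integral_Iic_integral_fejer_sub (μ : Measure ℝ) [IsProbabilityMeasure μ] {δ : ℝ}
    (hδ : 0 < δ) (a : ℝ) :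
    ∫ v in Iic a, ∫ x, fejer δ (v - x) ∂μ = ∫ u, fejer δ u * cdf μ (a - u) := by
  have hc := continuous_fejer δ
  have hs : MeasurableSet {p : ℝ × ℝ | p.1 + p.2 ≤ a} :=
    measurableSet_le (by fun_prop) measurable_const
  have h1 : Integrable (Function.uncurry fun v x => fejer δ (v - x))
      ((volume.restrict (Iic a)).prod μ) := by
    have := (integrable_fejer_sub μ hδ).restrict (s := Iic a ×ˢ univ)
    rwa [← Measure.prod_restrict, Measure.restrict_univ] at this
  have h2 : Integrable (Function.uncurry fun x u : ℝ =>
      {p : ℝ × ℝ | p.1 + p.2 ≤ a}.indicator (fun p => fejer δ p.2) (x, u)) (μ.prod volume) :=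
    ((integrable_fejer hδ).comp_snd μ).indicator hs
  rw [integral_integral_swap h1]
  have h3 : ∀ x, ∫ v in Iic a, fejer δ (v - x) =
      ∫ u, {p : ℝ × ℝ | p.1 + p.2 ≤ a}.indicator (fun p => fejer δ p.2) (x, u) := by
    intro x
    rw [← integral_indicator measurableSet_Iic, ← integral_add_right_eq_self _ x]
    refine integral_congr_ae (ae_of_all _ fun u => ?_)
    simp only [indicator, mem_Iic, mem_ofPred_eq, add_comm u x, add_sub_cancel_left]
  simp_rw [h3]
  rw [integral_integral_swap h2]
  refine integral_congr_ae (ae_of_all _ fun u => ?_)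
  have h4 : (fun x => {p : ℝ × ℝ | p.1 + p.2 ≤ a}.indicator (fun p => fejer δ p.2) (x, u)) =
      (Iic (a - u)).indicator (fun _ => fejer δ u) := by
    ext x
    simp only [indicator, mem_Iic, mem_ofPred_eq, le_sub_iff_add_le]
  simp only [h4]
  rw [integral_indicator_const _ measurableSet_Iic, cdf_eq_real, smul_eq_mul, mul_comm]

lemma integrable_fejer_mul_cdf (μ : Measure ℝ) {δ : ℝ} (hδ : 0 < δ) (a : ℝ) :
    Integrable (fun u => fejer δ u * cdf μ (a - u)) := by
  refine (integrable_fejer hδ).mul_bdd (c := 1) ?_ (ae_of_all _ fun u => ?_)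
  · exact ((monotone_cdf μ).measurable.comp (by fun_prop)).aestronglyMeasurable
  · rw [Real.norm_of_nonneg (cdf_nonneg μ _)]
    exact cdf_le_one μ _

lemma abs_integral_fejer_mul_cdf_sub_le (μ ν : Measure ℝ) [IsProbabilityMeasure μ]
    [IsProbabilityMeasure ν] {δ : ℝ} (hδ : 0 < δ) {b : ℝ → ℝ} (hb : Continuous b)
    (hφ : ∀ t ∈ Ioc 0 δ, ‖charFun μ t - charFun ν t‖ ≤ t * b t) (a : ℝ) :
    |∫ u, fejer δ u * (cdf μ (a - u) - cdf ν (a - u))| ≤ 2 * ∫ t in (0 : ℝ)..δ, b t := by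
  have hi : ∀ ρ : Measure ℝ, IsProbabilityMeasure ρ →
      Integrable (fun v => ∫ x, fejer δ (v - x) ∂ρ) := fun ρ _ =>
    (integrable_fejer_sub ρ hδ).integral_prod_left
  have h := intervalIntegral_tendsto_integral_Iic a
    ((hi μ inferInstance).sub (hi ν inferInstance)).integrableOn tendsto_id
  have h1 : ∫ u, fejer δ u * (cdf μ (a - u) - cdf ν (a - u)) =
      ∫ v in Iic a, (∫ x, fejer δ (v - x) ∂μ - ∫ x, fejer δ (v - x) ∂ν) := by
    rw [integral_sub (hi μ inferInstance).integrableOn (hi ν inferInstance).integrableOn,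
      integral_Iic_integral_fejer_sub μ hδ, integral_Iic_integral_fejer_sub ν hδ,
      ← integral_sub (integrable_fejer_mul_cdf μ hδ a) (integrable_fejer_mul_cdf ν hδ a)]
    simp only [mul_sub]
  rw [h1]
  refine le_of_tendsto h.abs ?_
  filter_upwards [eventually_le_atBot a] with a₀ ha₀
  exact abs_integral_fejer_diff_le μ ν hδ hb hφ ha₀

/-- Since `D` cannot fall faster than slope `m`, it stays above `D x - 2Lm` on `[x, x + 2L]`.
Averaging around the midpoint `x + L` puts at least three quarters of the kernel mass there, while
the rest contributes at worst `-Δ`. The resulting coefficient `1/3` of `Δ` is less than `1`, so `Δ`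
can later be absorbed. -/
lemma le_of_integral_smoothed_le {h : ℝ → ℝ} (h0 : ∀ u, 0 ≤ h u) (hi : Integrable h)
    {L : ℝ} (hL : ∫ u in (Icc (-L) L)ᶜ, h u ≤ (∫ u, h u) / 4)
    {D : ℝ → ℝ} (hD : Measurable D) {Δ m B : ℝ} (hDΔ : ∀ x, |D x| ≤ Δ) (hm : 0 ≤ m)
    (hDm : ∀ x y, x ≤ y → D x - m * (y - x) ≤ D y) (hpos : 0 < ∫ u, h u)
    (hB : ∀ a, |∫ u, h u * D (a - u)| ≤ B) (x : ℝ) :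
    D x ≤ 2 * L * m + Δ / 3 + 4 * B / (3 * ∫ u, h u) := by
  have hΔ : 0 ≤ Δ := (abs_nonneg _).trans (hDΔ 0)
  have hB0 : 0 ≤ B := (abs_nonneg _).trans (hB 0)
  set d := D x - 2 * L * m with hd
  -- The tail bound gets multiplied by `d + Δ`, so its sign matters; if it is nonpositive the claim
  -- is immediate.
  rcases le_total (d + Δ) 0 with hneg | hnn
  · have : 0 ≤ 4 * B / (3 * ∫ u, h u) := by positivity
    linarith
  have hlow : ∀ u, d * h u - (d + Δ) * (Icc (-L) L)ᶜ.indicator h u ≤ h u * D (x + L - u) := by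
    intro u
    by_cases hu : u ∈ Icc (-L) L
    · rw [indicator_of_notMem (by simpa using hu)]
      have h1 := hDm x (x + L - u) (by linarith [hu.2])
      have h2 : d ≤ D (x + L - u) := by
        refine le_trans ?_ h1
        have : m * (x + L - u - x) ≤ m * (2 * L) := by
          gcongr
          linarith [hu.1]
        linarith
      nlinarith [h0 u]
    · rw [indicator_of_mem (by simpa using hu)]
      nlinarith [h0 u, (abs_le.1 (hDΔ (x + L - u))).1]
  have hmeas : MeasurableSet (Icc (-L) L)ᶜ := measurableSet_Icc.compl
  have hint : Integrable (fun u => h u * D (x + L - u)) :=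
    hi.mul_bdd (c := Δ) (hD.comp (by fun_prop)).aestronglyMeasurable (ae_of_all _ fun u => hDΔ _)
  have hle := integral_mono
    ((hi.const_mul d).sub ((hi.indicator hmeas).const_mul (d + Δ))) hint hlow
  simp only [Pi.sub_apply] at hle
  rw [integral_sub (hi.const_mul d) ((hi.indicator hmeas).const_mul (d + Δ)), integral_const_mul,
    integral_const_mul, integral_indicator hmeas] at hle
  have hub := (le_abs_self _).trans (hB (x + L))
  set I := ∫ u, h u
  have h3 : (d + Δ) * ∫ u in (Icc (-L) L)ᶜ, h u ≤ (d + Δ) * (I / 4) := by gcongr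
  have h4 : 3 * I * d ≤ I * Δ + 4 * B := by linarith
  have h5 : d ≤ Δ / 3 + 4 * B / (3 * I) := by
    rw [show Δ / 3 + 4 * B / (3 * I) = (I * Δ + 4 * B) / (3 * I) by field_simp,
      le_div_iff₀ (by positivity)]
    linarith
  linarith

/-- Esseen's smoothing inequality: the distance of two distribution functions is controlled by the
difference of the characteristic functions on a fixed interval and a Lipschitz constant of one of
them. -/
theorem exists_abs_cdf_sub_le {δ : ℝ} (hδ : 0 < δ) :
    ∃ c : ℝ, 0 < c ∧ ∀ (μ ν : Measure ℝ) [IsProbabilityMeasure μ] [IsProbabilityMeasure ν]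
      (b : ℝ → ℝ) (m : ℝ), Continuous b →
      (∀ t ∈ Ioc 0 δ, ‖charFun μ t - charFun ν t‖ ≤ t * b t) → 0 ≤ m →
      (∀ x y, x ≤ y → cdf ν y - cdf ν x ≤ m * (y - x)) →
      ∀ x, |cdf μ x - cdf ν x| ≤ c * (m + ∫ t in (0 : ℝ)..δ, b t) := by
  have hI := integral_fejer_pos hδ
  obtain ⟨L, hL0, hL⟩ : ∃ L : ℝ, 0 ≤ L ∧
      ∫ u in (Icc (-L) L)ᶜ, fejer δ u ≤ (∫ u, fejer δ u) / 4 := by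
    have ht := intervalIntegral_tendsto_integral (integrable_fejer hδ) tendsto_neg_atTop_atBot
      tendsto_id
    obtain ⟨L, h1, h2⟩ := ((ht.eventually (lt_mem_nhds
      (show 3 * (∫ u, fejer δ u) / 4 < ∫ u, fejer δ u by linarith))).and
        (eventually_ge_atTop 0)).exists
    refine ⟨L, h2, ?_⟩
    have h3 := integral_add_compl (s := Icc (-L) L) measurableSet_Icc (integrable_fejer hδ)
    rw [id, intervalIntegral.integral_of_le (by linarith), ← integral_Icc_eq_integral_Ioc] at h1
    linarith
  set I := ∫ u, fejer δ u
  refine ⟨3 * L + 4 / I, by positivity, ?_⟩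
  intro μ ν _ _ b m hb hφ hm hν
  set B := 2 * ∫ t in (0 : ℝ)..δ, b t with hB
  set D : ℝ → ℝ := fun x => cdf μ x - cdf ν x with hD
  have hDm : Measurable D := (monotone_cdf μ).measurable.sub (monotone_cdf ν).measurable
  have hDint : ∀ a, |∫ u, fejer δ u * D (a - u)| ≤ B := fun a =>
    abs_integral_fejer_mul_cdf_sub_le μ ν hδ hb hφ a
  have hB0 : 0 ≤ B := (abs_nonneg _).trans (hDint 0)
  have hD1 : ∀ x, |D x| ≤ 1 := fun x => abs_le.2 ⟨by
    linarith [cdf_nonneg μ x, cdf_le_one ν x], by linarith [cdf_nonneg ν x, cdf_le_one μ x]⟩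
  have hDmono : ∀ x y, x ≤ y → D x - m * (y - x) ≤ D y := fun x y hxy => by
    have := hν x y hxy
    have := monotone_cdf μ hxy
    simp only [hD]
    linarith
  have hbdd : BddAbove (range fun x => |D x|) := ⟨1, by rintro _ ⟨x, rfl⟩; exact hD1 x⟩
  set Δ := ⨆ x, |D x|
  have hDΔ : ∀ x, |D x| ≤ Δ := fun x => le_ciSup hbdd x
  have hup := le_of_integral_smoothed_le (fejer_nonneg hδ) (integrable_fejer hδ) hL hDm hDΔ hm
    hDmono hI hDint
  -- The reflection `x ↦ -D (-x)` keeps the one-sided slope condition, and the kernel is even, so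
  -- the lower bound follows from the upper one.
  have hdown := le_of_integral_smoothed_le (fejer_nonneg hδ) (integrable_fejer hδ) hL
    (D := fun x => -D (-x)) (Δ := Δ) (B := B) (m := m) (hDm.comp measurable_neg).neg
    (fun x => by rw [abs_neg]; exact hDΔ _) hm
    (fun x y hxy => by have := hDmono (-y) (-x) (by linarith); linarith) hI
    (fun a => by
      have : ∫ u, fejer δ u * -D (-(a - u)) = -∫ u, fejer δ u * D (-a - u) := by
        rw [← integral_neg, ← integral_neg_eq_self]
        refine integral_congr_ae (ae_of_all _ fun u => ?_)
        simp only [fejer_neg]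
        rw [show -(a - -u) = -a - u by ring]
        ring
      rw [this, abs_neg]
      exact hDint _)
  have hall : ∀ x, |D x| ≤ 2 * L * m + Δ / 3 + 4 * B / (3 * I) := fun x => abs_le.2 ⟨by
    have := hdown (-x)
    simp only [neg_neg] at this
    linarith, hup x⟩
  have hfin : Δ ≤ 2 * L * m + Δ / 3 + 4 * B / (3 * I) := ciSup_le hall
  have hΔ : Δ ≤ 3 * L * m + 2 * B / I := by
    have : 4 * B / (3 * I) = 2 / 3 * (2 * B / I) := by field_simp; ring
    linarith
  intro x
  refine (hDΔ x).trans (hΔ.trans ?_)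
  have h1 : 0 ≤ 4 / I * m := by positivity
  have h2 : 0 ≤ 3 * L * (∫ t in (0 : ℝ)..δ, b t) := by
    have : 0 ≤ ∫ t in (0 : ℝ)..δ, b t := by linarith
    positivity
  have h3 : 2 * B / I = 4 / I * ∫ t in (0 : ℝ)..δ, b t := by rw [hB]; ring
  rw [h3]
  nlinarith

end Smoothing

/-! ### Laws on finite sample spaces -/

section Law

open MeasureTheory ProbabilityTheory Set

variable {Ω : Type*} [Fintype Ω]

/-- The law of `f` when the finite sample space carries the weights `p`. -/
noncomputable def finiteLaw (p f : Ω → ℝ) : Measure ℝ :=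
  ∑ ω, ENNReal.ofReal (p ω) • Measure.dirac (f ω)

lemma isProbabilityMeasure_finiteLaw {p : Ω → ℝ} (hp : ∀ ω, 0 ≤ p ω) (hp1 : ∑ ω, p ω = 1)
    (f : Ω → ℝ) : IsProbabilityMeasure (finiteLaw p f) := by
  refine ⟨?_⟩
  simp [finiteLaw, ← ENNReal.ofReal_sum_of_nonneg fun ω _ => hp ω, hp1]

lemma integral_finiteLaw {E : Type*} [NormedAddCommGroup E] [NormedSpace ℝ E] [CompleteSpace E]
    {p : Ω → ℝ} (hp : ∀ ω, 0 ≤ p ω) (f : Ω → ℝ) (g : ℝ → E) :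
    ∫ x, g x ∂(finiteLaw p f) = ∑ ω, p ω • g (f ω) := by
  have hi : ∀ ω, Integrable g (ENNReal.ofReal (p ω) • Measure.dirac (f ω)) := fun ω =>
    (integrable_dirac (by simp)).smul_measure ENNReal.ofReal_ne_top
  rw [finiteLaw, integral_finsetSum_measure fun ω _ => hi ω]
  refine Finset.sum_congr rfl fun ω _ => ?_
  rw [integral_smul_measure, integral_dirac, ENNReal.toReal_ofReal (hp ω)]

lemma cdf_finiteLaw {p : Ω → ℝ} (hp : ∀ ω, 0 ≤ p ω) (hp1 : ∑ ω, p ω = 1) (f : Ω → ℝ) (x : ℝ) :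
    cdf (finiteLaw p f) x = ∑ ω, p ω * if f ω ≤ x then 1 else 0 := by
  have := isProbabilityMeasure_finiteLaw hp hp1 f
  rw [cdf_eq_real, ← integral_indicator_one measurableSet_Iic, integral_finiteLaw hp]
  simp [indicator]

lemma charFun_finiteLaw {p : Ω → ℝ} (hp : ∀ ω, 0 ≤ p ω) (f : Ω → ℝ) (t : ℝ) :
    charFun (finiteLaw p f) t = ∑ ω, (p ω : ℂ) * Complex.exp (t * f ω * Complex.I) := by
  rw [charFun_apply_real, integral_finiteLaw hp]
  simp

lemma sum_prod_eq_one {p : Ω → ℝ} (hp1 : ∑ ω, p ω = 1) (n : ℕ) :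
    ∑ ω : Fin n → Ω, ∏ i, p (ω i) = 1 := by
  rw [← Fintype.sum_pow, hp1, one_pow]

lemma charFun_finiteLaw_sum {p : Ω → ℝ} (hp : ∀ ω, 0 ≤ p ω) (f : Ω → ℝ) (n : ℕ) (t : ℝ) :
    charFun (finiteLaw (fun ω : Fin n → Ω => ∏ i, p (ω i)) fun ω => ∑ i, f (ω i)) t =
      (charFun (finiteLaw p f) t) ^ n := by
  rw [charFun_finiteLaw (fun ω => Finset.prod_nonneg fun i _ => hp _), charFun_finiteLaw hp,
    Fintype.sum_pow]
  refine Finset.sum_congr rfl fun ω _ => ?_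
  push_cast
  rw [Finset.prod_mul_distrib, ← Complex.exp_sum, Finset.mul_sum, Finset.sum_mul]

end Law

/-! ### The standard normal distribution function -/

section StdNormal

open MeasureTheory ProbabilityTheory Set

lemma stdNormalCDF_sub_eq {x y : ℝ} (hxy : x ≤ y) :
    stdNormalCDF y - stdNormalCDF x = ∫ t in Ioc x y, gaussianPDFReal 0 1 t := by
  have h0 : Ioc x y = Iic y \ Iic x := by ext; simp [and_comm]
  have h1 : stdNormalCDF y - stdNormalCDF x = (gaussianReal 0 1).real (Ioc x y) := by
    rw [stdNormalCDF, stdNormalCDF, cdf_eq_real, cdf_eq_real, h0,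
      measureReal_sdiff (Iic_subset_Iic.2 hxy) measurableSet_Iic]
  rw [h1, measureReal_def, gaussianReal_apply_eq_integral 0 one_ne_zero,
    ENNReal.toReal_ofReal (integral_nonneg fun t => gaussianPDFReal_nonneg 0 1 t)]

lemma stdNormalCDF_mono : Monotone stdNormalCDF := monotone_cdf _

lemma stdNormalCDF_sub_le {x y : ℝ} (hxy : x ≤ y) :
    stdNormalCDF y - stdNormalCDF x ≤ y - x := by
  rw [stdNormalCDF_sub_eq hxy]
  have h : ∀ t, gaussianPDFReal 0 1 t ≤ 1 := by
    intro t
    rw [gaussianPDFReal_def]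
    have h1 : (√(2 * Real.pi * (1 : NNReal)))⁻¹ ≤ 1 := by
      apply inv_le_one_of_one_le₀
      rw [Real.one_le_sqrt]
      have := Real.pi_gt_three
      simp
      linarith
    have h2 : Real.exp (-(t - 0) ^ 2 / (2 * (1 : NNReal))) ≤ 1 := by
      rw [Real.exp_le_one_iff]
      exact div_nonpos_of_nonpos_of_nonneg (by nlinarith [sq_nonneg (t - 0)]) (by positivity)
    exact mul_le_one₀ h1 (Real.exp_nonneg _) h2
  refine (setIntegral_mono (integrable_gaussianPDFReal 0 1).integrableOn
    (integrable_const (1 : ℝ)) h).trans ?_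
  simp [hxy]

lemma cdf_gaussianReal_zero {v : ℝ} (hv : 0 < v) (x : ℝ) :
    cdf (gaussianReal 0 v.toNNReal) x = stdNormalCDF (x / √v) := by
  have hs : 0 < √v := Real.sqrt_pos.2 hv
  have h : (gaussianReal 0 1).map (√v * ·) = gaussianReal 0 v.toNNReal := by
    rw [gaussianReal_map_const_mul]
    congr 1
    · simp
    · ext
      simp [Real.sq_sqrt hv.le, hv.le]
  rw [stdNormalCDF, cdf_eq_real, cdf_eq_real, ← h,
    map_measureReal_apply (by fun_prop) measurableSet_Iic]
  congr 1
  ext t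
  simp [le_div_iff₀ hs, mul_comm]

end StdNormal

/-! ### Characteristic function estimates and Berry–Esseen -/

section CharFun

open MeasureTheory ProbabilityTheory Set

/-- This is the telescoping bound with `r ^ (n - 1)`, multiplied by `r` to avoid truncated
subtraction. In the application `r ≥ 1/3`, so the extra factor costs only a constant. -/
lemma norm_pow_sub_pow_le {a b : ℂ} {r : ℝ} (ha : ‖a‖ ≤ r) (hb : ‖b‖ ≤ r) (n : ℕ) :
    ‖a ^ n - b ^ n‖ * r ≤ n * ‖a - b‖ * r ^ n := by
  have hr : 0 ≤ r := (norm_nonneg _).trans ha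
  induction n with
  | zero => simp
  | succ n ih =>
    have h1 : a ^ (n + 1) - b ^ (n + 1) = a * (a ^ n - b ^ n) + (a - b) * b ^ n := by ring
    have h2 : ‖b ^ n‖ ≤ r ^ n := by rw [norm_pow]; gcongr
    calc ‖a ^ (n + 1) - b ^ (n + 1)‖ * r
        ≤ (‖a‖ * ‖a ^ n - b ^ n‖ + ‖a - b‖ * ‖b ^ n‖) * r := by
          rw [h1]
          gcongr
          exact (norm_add_le _ _).trans (by rw [norm_mul, norm_mul])
      _ = ‖a‖ * (‖a ^ n - b ^ n‖ * r) + ‖a - b‖ * ‖b ^ n‖ * r := by ring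
      _ ≤ r * (n * ‖a - b‖ * r ^ n) + ‖a - b‖ * r ^ n * r := by gcongr
      _ = _ := by push_cast; ring

variable {Ω : Type*} [Fintype Ω]

lemma norm_charFun_finiteLaw_sub_le {p f : Ω → ℝ} (hp : ∀ ω, 0 ≤ p ω) (hp1 : ∑ ω, p ω = 1)
    (hf : ∑ ω, p ω * f ω = 0) {R : ℝ} (hR : ∀ ω, |f ω| ≤ R) {t : ℝ} (ht : 0 ≤ t)
    (htR : t * R ≤ 1) :
    ‖charFun (finiteLaw p f) t - ((1 - (∑ ω, p ω * f ω ^ 2) * t ^ 2 / 2 : ℝ) : ℂ)‖ ≤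
      R ^ 3 * t ^ 3 := by
  have h1 : charFun (finiteLaw p f) t - ((1 - (∑ ω, p ω * f ω ^ 2) * t ^ 2 / 2 : ℝ) : ℂ) =
      ∑ ω, (p ω : ℂ) * (Complex.exp (t * f ω * Complex.I) -
        ∑ m ∈ Finset.range 3, (t * f ω * Complex.I) ^ m / m.factorial) := by
    have h2 : ∀ ω, (p ω : ℂ) * (Complex.exp (t * f ω * Complex.I) -
        ∑ m ∈ Finset.range 3, (t * f ω * Complex.I) ^ m / m.factorial) =
        p ω * Complex.exp (t * f ω * Complex.I) - ((p ω : ℂ) + (p ω * f ω : ℂ) * (t * Complex.I) -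
          (p ω * f ω ^ 2 : ℂ) * (t ^ 2 / 2)) := by
      intro ω
      simp only [Finset.sum_range_succ, Finset.sum_range_zero, Nat.factorial]
      have := Complex.I_sq
      push_cast
      linear_combination (-(p ω : ℂ) * t ^ 2 * f ω ^ 2 / 2) * this
    have c1 : ∑ ω, (p ω : ℂ) = 1 := by exact_mod_cast hp1
    have c2 : ∑ ω, (p ω * f ω : ℂ) = 0 := by exact_mod_cast hf
    simp_rw [h2]
    rw [Finset.sum_sub_distrib, Finset.sum_sub_distrib, Finset.sum_add_distrib, ← Finset.sum_mul,
      ← Finset.sum_mul, c1, c2, charFun_finiteLaw hp]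
    push_cast
    ring
  rw [h1]
  have h3 : ∀ ω, ‖(p ω : ℂ) * (Complex.exp (t * f ω * Complex.I) -
        ∑ m ∈ Finset.range 3, (t * f ω * Complex.I) ^ m / m.factorial)‖ ≤
        p ω * (R ^ 3 * t ^ 3) := by
    intro ω
    have hn : ‖(t * f ω * Complex.I : ℂ)‖ = t * |f ω| := by simp [abs_of_nonneg ht]
    have hle : t * |f ω| ≤ t * R := by gcongr; exact hR ω
    rw [norm_mul, Complex.norm_real, Real.norm_of_nonneg (hp ω)]
    gcongr
    · exact hp ω
    · refine (Complex.exp_bound (by rw [hn]; linarith) (by norm_num : 0 < 3)).trans ?_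
      rw [hn]
      have h4 : (t * |f ω|) ^ 3 ≤ (t * R) ^ 3 := by gcongr
      have h5 : 0 ≤ (t * |f ω|) ^ 3 := by positivity
      norm_num [Nat.factorial]
      nlinarith
  refine (norm_sum_le _ _).trans ((Finset.sum_le_sum fun ω _ => h3 ω).trans ?_)
  rw [← Finset.sum_mul, hp1, one_mul]

/-- Both the characteristic function and its Gaussian counterpart lie within `R³t³` of `1 - Vt²/2`.
The range `t ≤ V/(4R³)` makes this error at most `Vt²/4`, so both moduli are at most `exp (-Vt²/4)`,
and powers can be compared without losing the Gaussian decay. -/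
lemma norm_charFun_pow_sub_exp_le {p f : Ω → ℝ} (hp : ∀ ω, 0 ≤ p ω) (hp1 : ∑ ω, p ω = 1)
    (hf : ∑ ω, p ω * f ω = 0) {V R : ℝ} (hV : ∑ ω, p ω * f ω ^ 2 = V) (hV0 : 0 < V)
    (hR0 : 0 < R) (hR : ∀ ω, |f ω| ≤ R) {t : ℝ} (ht : 0 < t) (htδ : t ≤ V / (4 * R ^ 3)) (n : ℕ) :
    ‖charFun (finiteLaw p f) t ^ n - Complex.exp (-(n * V * t ^ 2 / 2))‖ ≤
      t * (6 * n * R ^ 3 * (t ^ 2 * Real.exp (-(n * V / 4) * t ^ 2))) := by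
  have hVR : V ≤ R ^ 2 := by
    rw [← hV]
    calc ∑ ω, p ω * f ω ^ 2 ≤ ∑ ω, p ω * R ^ 2 := by
          refine Finset.sum_le_sum fun ω _ => ?_
          have := hp ω
          have := sq_le_sq' (by linarith [(abs_le.1 (hR ω)).1]) (abs_le.1 (hR ω)).2
          gcongr
      _ = R ^ 2 := by rw [← Finset.sum_mul, hp1, one_mul]
  have ht3 : R ^ 3 * t ≤ V / 4 := by
    rw [le_div_iff₀ (by positivity)] at htδ
    linarith
  have htR : t * R ≤ 1 / 4 := by
    have : R ^ 2 * (t * R) ≤ R ^ 2 * (1 / 4) := by linarith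
    exact le_of_mul_le_mul_left this (by positivity)
  have htR0 : 0 < t * R := by positivity
  have hVt : V * t ^ 2 ≤ 1 / 16 := by
    calc V * t ^ 2 ≤ R ^ 2 * t ^ 2 := by gcongr
      _ = (t * R) ^ 2 := by ring
      _ ≤ (1 / 4) ^ 2 := by gcongr
      _ = 1 / 16 := by norm_num
  have hVt0 : 0 < V * t ^ 2 := by positivity
  set φ := charFun (finiteLaw p f) t
  set γ : ℂ := ((Real.exp (-(V * t ^ 2 / 2)) : ℝ) : ℂ) with hγ
  set r := Real.exp (-(V * t ^ 2 / 4)) with hr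
  have h1 := norm_charFun_finiteLaw_sub_le hp hp1 hf hR ht.le (by linarith)
  rw [hV] at h1
  have h2 : ‖((1 - V * t ^ 2 / 2 : ℝ) : ℂ) - γ‖ ≤ R ^ 3 * t ^ 3 := by
    rw [hγ, ← Complex.ofReal_sub, Complex.norm_real, Real.norm_eq_abs, abs_sub_comm]
    have := Real.abs_exp_sub_one_sub_id_le (x := -(V * t ^ 2 / 2))
      (by rw [abs_neg, abs_of_pos (by linarith)]; linarith)
    rw [show Real.exp (-(V * t ^ 2 / 2)) - (1 - V * t ^ 2 / 2) =
      Real.exp (-(V * t ^ 2 / 2)) - 1 - -(V * t ^ 2 / 2) by ring]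
    refine this.trans ?_
    calc (-(V * t ^ 2 / 2)) ^ 2 = (V * t ^ 2) * (V * t ^ 2) / 4 := by ring
      _ ≤ (R ^ 2 * t ^ 2) * (R ^ 2 * t ^ 2) / 4 := by gcongr
      _ = R ^ 3 * t ^ 3 * (t * R) / 4 := by ring
      _ ≤ R ^ 3 * t ^ 3 * 1 := by
        have : 0 < R ^ 3 * t ^ 3 := by positivity
        nlinarith
      _ = _ := mul_one _
  have h3 : ‖φ - γ‖ ≤ 2 * (R ^ 3 * t ^ 3) := by
    have := norm_sub_le_norm_sub_add_norm_sub φ ((1 - V * t ^ 2 / 2 : ℝ) : ℂ) γ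
    linarith
  have h4 : ‖φ‖ ≤ r := by
    have h5 : ‖((1 - V * t ^ 2 / 2 : ℝ) : ℂ)‖ = 1 - V * t ^ 2 / 2 := by
      rw [Complex.norm_real, Real.norm_of_nonneg (by linarith)]
    have h6 := norm_le_norm_add_norm_sub' φ ((1 - V * t ^ 2 / 2 : ℝ) : ℂ)
    have h7 : R ^ 3 * t ^ 3 ≤ V * t ^ 2 / 4 := by
      have : R ^ 3 * t * t ^ 2 ≤ V / 4 * t ^ 2 := by gcongr
      linarith
    have h8 := Real.add_one_le_exp (-(V * t ^ 2 / 4))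
    linarith
  have h5 : ‖γ‖ ≤ r := by
    rw [hγ, Complex.norm_real, Real.norm_of_nonneg (Real.exp_nonneg _)]
    apply Real.exp_le_exp.2
    linarith
  have hr3 : 1 ≤ 3 * r := by
    have := Real.add_one_le_exp (-(V * t ^ 2 / 4))
    linarith
  have hrn : r ^ n = Real.exp (-(n * V / 4) * t ^ 2) := by
    rw [hr, ← Real.exp_nat_mul]
    ring_nf
  have hγn : γ ^ n = Complex.exp (-(n * V * t ^ 2 / 2)) := by
    rw [hγ, ← Complex.ofReal_pow, ← Real.exp_nat_mul]
    push_cast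
    ring_nf
  have h6 := norm_pow_sub_pow_le h4 h5 n
  rw [← hγn, ← hrn]
  calc ‖φ ^ n - γ ^ n‖ ≤ ‖φ ^ n - γ ^ n‖ * (3 * r) := le_mul_of_one_le_right (norm_nonneg _) hr3
    _ = 3 * (‖φ ^ n - γ ^ n‖ * r) := by ring
    _ ≤ 3 * (n * ‖φ - γ‖ * r ^ n) := by gcongr
    _ ≤ 3 * (n * (2 * (R ^ 3 * t ^ 3)) * r ^ n) := by
      have : 0 ≤ r := (Real.exp_pos _).le
      gcongr
    _ = _ := by ring

/-- Half of the Gaussian exponent absorbs `t²`, by `x exp (-x) ≤ 1`. With `c` proportional to `n`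
the bound is of order `n^(-3/2)`. -/
lemma integral_sq_mul_exp_neg_le {c δ : ℝ} (hc : 0 < c) (hδ : 0 ≤ δ) :
    ∫ t in (0 : ℝ)..δ, t ^ 2 * Real.exp (-c * t ^ 2) ≤ 2 / c * √(Real.pi / (c / 2)) := by
  have hi : Integrable fun t : ℝ => 2 / c * Real.exp (-(c / 2) * t ^ 2) :=
    (integrable_exp_neg_mul_sq (by positivity)).const_mul _
  rw [← integral_gaussian, ← integral_const_mul, intervalIntegral.integral_of_le hδ]
  refine le_trans ?_ (setIntegral_le_integral (s := Ioc 0 δ) hi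
    (Filter.Eventually.of_forall fun t => by positivity))
  refine setIntegral_mono (Continuous.integrableOn_Ioc (by fun_prop)) hi.integrableOn fun t => ?_
  have h1 : Real.exp (-c * t ^ 2) = Real.exp (-(c / 2) * t ^ 2) * Real.exp (-(c / 2) * t ^ 2) := by
    rw [← Real.exp_add]; ring_nf
  have h2 : c / 2 * t ^ 2 * Real.exp (-(c / 2) * t ^ 2) ≤ 1 := by
    have := Real.add_one_le_exp (c / 2 * t ^ 2)
    rw [neg_mul, Real.exp_neg, mul_inv_le_iff₀ (Real.exp_pos _)]
    linarith
  have h3 := Real.exp_pos (-(c / 2) * t ^ 2)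
  show t ^ 2 * Real.exp (-c * t ^ 2) ≤ 2 / c * Real.exp (-(c / 2) * t ^ 2)
  calc t ^ 2 * Real.exp (-c * t ^ 2)
      = 2 / c * Real.exp (-(c / 2) * t ^ 2) * (c / 2 * t ^ 2 * Real.exp (-(c / 2) * t ^ 2)) := by
        rw [h1]; field_simp
    _ ≤ 2 / c * Real.exp (-(c / 2) * t ^ 2) * 1 := by gcongr
    _ = _ := mul_one _

/-- The Berry–Esseen theorem for centered random variables on a finite sample space. -/
theorem exists_berryEsseen_centered {p f : Ω → ℝ} (hp : ∀ ω, 0 ≤ p ω) (hp1 : ∑ ω, p ω = 1)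
    (hf : ∑ ω, p ω * f ω = 0) {V : ℝ} (hV : ∑ ω, p ω * f ω ^ 2 = V) (hV0 : 0 < V) :
    ∃ K : ℝ, 0 < K ∧ ∀ n : ℕ, 1 ≤ n → ∀ a : ℝ,
      |(∑ ω : Fin n → Ω, (∏ i, p (ω i)) * if ∑ i, f (ω i) ≤ a then 1 else 0) -
        stdNormalCDF (a / √(n * V))| ≤ K / √n := by
  set R : ℝ := 1 + ∑ ω, |f ω| with hRdef
  have hR0 : 0 < R := by positivity
  have hR : ∀ ω, |f ω| ≤ R := fun ω => by
    have := Finset.single_le_sum (fun i _ => abs_nonneg (f i)) (Finset.mem_univ ω)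
    linarith
  -- The sums are not normalized, so the bandwidth, and with it the smoothing constant, is
  -- independent of `n`. The rate comes from the Lipschitz constant `1/√(nV)` of the Gaussian and
  -- from `n · n^(-3/2)` in the integral.
  have hδ : 0 < V / (4 * R ^ 3) := by positivity
  obtain ⟨c, hc, hs⟩ := exists_abs_cdf_sub_le hδ
  refine ⟨c * (1 / √V + 6 * R ^ 3 * (8 / V * √(Real.pi / (V / 8)))), by positivity, ?_⟩
  intro n hn a
  have hn0 : (0 : ℝ) < n := by exact_mod_cast hn
  have hsn : 0 < √(n : ℝ) := Real.sqrt_pos.2 hn0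
  have hnV : 0 < n * V := by positivity
  have hprod : ∀ ω : Fin n → Ω, 0 ≤ ∏ i, p (ω i) := fun ω => Finset.prod_nonneg fun i _ => hp _
  have hP := isProbabilityMeasure_finiteLaw hprod (sum_prod_eq_one hp1 n) fun ω => ∑ i, f (ω i)
  have h := hs (finiteLaw (fun ω : Fin n → Ω => ∏ i, p (ω i)) fun ω => ∑ i, f (ω i))
    (gaussianReal 0 (n * V).toNNReal)
    (fun t => 6 * n * R ^ 3 * (t ^ 2 * Real.exp (-(n * V / 4) * t ^ 2))) (1 / √(n * V))
    (by fun_prop) (by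
      intro t ht
      rw [charFun_finiteLaw_sum hp, charFun_gaussianReal]
      have := norm_charFun_pow_sub_exp_le hp hp1 hf hV hV0 hR0 hR ht.1 ht.2 n
      convert! this using 4
      simp [hnV.le]) (by positivity) (by
      intro x y hxy
      rw [cdf_gaussianReal_zero hnV, cdf_gaussianReal_zero hnV]
      refine (stdNormalCDF_sub_le (by gcongr)).trans (le_of_eq ?_)
      ring) a
  rw [cdf_finiteLaw hprod (sum_prod_eq_one hp1 n), cdf_gaussianReal_zero hnV] at h
  refine h.trans ?_
  rw [mul_div_assoc c]
  gcongr
  rw [intervalIntegral.integral_const_mul]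
  have h1 := integral_sq_mul_exp_neg_le (c := n * V / 4) (by positivity) hδ.le
  have h2 : √(Real.pi / (n * V / 4 / 2)) = √(Real.pi / (V / 8)) / √n := by
    rw [← Real.sqrt_div (by positivity)]
    congr 1
    field_simp
    norm_num
  have h3 : 1 / √(n * V) = 1 / √V / √n := by
    rw [Real.sqrt_mul hn0.le]
    field_simp
  rw [h3, add_div]
  gcongr
  calc 6 * n * R ^ 3 * ∫ t in (0 : ℝ)..V / (4 * R ^ 3), t ^ 2 * Real.exp (-(n * V / 4) * t ^ 2)
      ≤ 6 * n * R ^ 3 * (2 / (n * V / 4) * √(Real.pi / (n * V / 4 / 2))) := by gcongr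
    _ = _ := by
      rw [h2]
      field_simp
      norm_num

/-- The Berry–Esseen theorem for random variables on a finite sample space. -/
theorem exists_berryEsseen {p f : Ω → ℝ} (hp : ∀ ω, 0 ≤ p ω) (hp1 : ∑ ω, p ω = 1)
    {C V : ℝ} (hf : ∑ ω, p ω * f ω = C) (hV : ∑ ω, p ω * (f ω - C) ^ 2 = V) (hV0 : 0 < V) :
    ∃ K : ℝ, 0 < K ∧ ∀ n : ℕ, 1 ≤ n → ∀ a : ℝ,
      |(∑ ω : Fin n → Ω, (∏ i, p (ω i)) * if ∑ i, f (ω i) ≤ a then 1 else 0) -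
        stdNormalCDF ((a - n * C) / √(n * V))| ≤ K / √n := by
  obtain ⟨K, hK, h⟩ := exists_berryEsseen_centered hp hp1 (f := fun ω => f ω - C)
    (by simp [mul_sub, Finset.sum_sub_distrib, hf, ← Finset.sum_mul, hp1]) hV hV0
  refine ⟨K, hK, fun n hn a => ?_⟩
  have := h n hn (a - n * C)
  simpa [Finset.sum_sub_distrib] using this

end CharFun

/-! ### Inverting the normal distribution function -/

section Quantile

open MeasureTheory ProbabilityTheory Set Filter

lemma le_stdNormalCDF_stdNormalQuantile {ε : ℝ} (hε : ε ∈ Ioo (0 : ℝ) 1) :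
    ε ≤ stdNormalCDF (stdNormalQuantile ε) := by
  have hne : {t : ℝ | ε ≤ stdNormalCDF t}.Nonempty := by
    obtain ⟨t, ht⟩ := ((tendsto_cdf_atTop (gaussianReal 0 1)).eventually
      (lt_mem_nhds hε.2)).exists
    exact ⟨t, ht.le⟩
  have hbdd : BddBelow {t : ℝ | ε ≤ stdNormalCDF t} := by
    obtain ⟨t, ht⟩ := ((tendsto_cdf_atBot (gaussianReal 0 1)).eventually
      (gt_mem_nhds hε.1)).exists
    refine ⟨t, fun s hs => ?_⟩
    by_contra! hst
    have h1 := stdNormalCDF_mono hst.le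
    have h2 : ε ≤ stdNormalCDF s := hs
    have h3 : stdNormalCDF t < ε := ht
    linarith
  refine le_of_forall_pos_le_add fun η hη => ?_
  obtain ⟨t, ht, htη⟩ := exists_lt_of_csInf_lt hne (lt_add_of_pos_right _ hη)
  have h0 : stdNormalQuantile ε ≤ t := csInf_le hbdd ht
  have h1 := stdNormalCDF_sub_le h0
  have h2 : ε ≤ stdNormalCDF t := ht
  have h3 : t < stdNormalQuantile ε + η := htη
  linarith

lemma exists_le_stdNormalQuantile_add {ε : ℝ} (hε : ε ∈ Ioo (0 : ℝ) 1) :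
    ∃ m : ℝ, 0 < m ∧ ∀ r, 0 < r → r ≤ m → ∀ s, stdNormalCDF s ≤ ε + r →
      s ≤ stdNormalQuantile ε + r / m := by
  set t₀ := stdNormalQuantile ε
  have hcont : Continuous (gaussianPDFReal 0 1) := by
    rw [gaussianPDFReal_def]
    fun_prop
  obtain ⟨x₀, -, hx₀⟩ := (isCompact_Icc (a := t₀) (b := t₀ + 1)).exists_isMinOn
    ⟨t₀, by simp⟩ hcont.continuousOn
  have hpos := gaussianPDFReal_pos 0 1 x₀ one_ne_zero
  -- Half the minimum of the density on `[t₀, t₀ + 1]`: a step of `r / m` then raises the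
  -- distribution function by at least `2r`, contradicting the allowed increase `r`. The condition
  -- `r ≤ m` keeps the step inside the interval.
  refine ⟨gaussianPDFReal 0 1 x₀ / 2, by positivity, fun r hr hrm s hs => ?_⟩
  set m := gaussianPDFReal 0 1 x₀
  by_contra! hlt
  set η := r / (m / 2) with hη
  have hη0 : 0 < η := by positivity
  have hη1 : η ≤ 1 := (div_le_one (by positivity)).2 hrm
  have h1 := stdNormalCDF_mono hlt.le
  have h2 : η * m ≤ stdNormalCDF (t₀ + η) - stdNormalCDF t₀ := by
    rw [stdNormalCDF_sub_eq (by linarith)]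
    have : ∫ _ in Ioc t₀ (t₀ + η), m = η * m := by simp [hη0.le]
    rw [← this]
    refine setIntegral_mono_on (by simp) (integrable_gaussianPDFReal 0 1).integrableOn
      measurableSet_Ioc fun t ht => ?_
    exact hx₀ ⟨ht.1.le, by linarith [ht.2]⟩
  have h3 := le_stdNormalCDF_stdNormalQuantile hε
  have h4 : η * m = 2 * r := by rw [hη]; field_simp
  linarith

end Quantile

/-! ### Exponentially smoothed tails -/

section Tail

open MeasureTheory Set

lemma integral_exp_neg_indicator (z a : ℝ) :
    ∫ u in Ioi (0 : ℝ), Real.exp (-u) * (if z ≤ a - u then 1 else 0) =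
      max 0 (1 - Real.exp (z - a)) := by
  have h1 : ∀ u, Real.exp (-u) * (if z ≤ a - u then (1 : ℝ) else 0) =
      (Iic (a - z)).indicator (fun u => Real.exp (-u)) u := by
    intro u
    by_cases h : z ≤ a - u
    · rw [indicator_of_mem (by simp; linarith), if_pos h, mul_one]
    · rw [indicator_of_notMem (by simp; linarith), if_neg h, mul_zero]
  simp_rw [h1]
  rw [setIntegral_indicator measurableSet_Iic, Ioi_inter_Iic]
  rcases le_total z a with h | h
  · rw [← intervalIntegral.integral_of_le (by linarith), intervalIntegral.integral_comp_neg
      (fun u => Real.exp u), integral_exp, max_eq_right]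
    · simp
    · have : Real.exp (z - a) ≤ 1 := Real.exp_le_one_iff.2 (by linarith)
      linarith
  · rw [Ioc_eq_empty (by linarith), max_eq_left]
    · simp
    · have : 1 ≤ Real.exp (z - a) := Real.one_le_exp (by linarith)
      linarith

lemma integrableOn_exp_neg_mul_self :
    IntegrableOn (fun u : ℝ => Real.exp (-u) * u) (Ioi 0) := by
  have := Real.GammaIntegral_convergent (s := 2) two_pos
  norm_num at this
  exact this

lemma integral_exp_neg_mul_self : ∫ u in Ioi (0 : ℝ), Real.exp (-u) * u = 1 := by
  have := Real.Gamma_eq_integral (s := 2) two_pos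
  rw [Real.Gamma_two] at this
  norm_num at this
  exact this.symm

variable {Ω : Type*} [Fintype Ω]

/-- A one-sided normal approximation for an exponentially smoothed tail of a sum of independent
random variables on a finite sample space. -/
theorem exists_stdNormalCDF_le_sum_exp {p f : Ω → ℝ} (hp : ∀ ω, 0 ≤ p ω) (hp1 : ∑ ω, p ω = 1)
    {C V : ℝ} (hf : ∑ ω, p ω * f ω = C) (hV : ∑ ω, p ω * (f ω - C) ^ 2 = V) (hV0 : 0 < V) :
    ∃ K : ℝ, 0 < K ∧ ∀ n : ℕ, 1 ≤ n → ∀ a : ℝ,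
      stdNormalCDF ((a - n * C) / √(n * V)) ≤
        (∑ ω : Fin n → Ω, (∏ i, p (ω i)) * max 0 (1 - Real.exp (∑ i, f (ω i) - a))) + K / √n := by
  obtain ⟨K, hK, h⟩ := exists_berryEsseen hp hp1 hf hV hV0
  -- `K` is the Berry–Esseen error, uniform in the shift `u`. The shift itself costs at most
  -- `u/√(nV)` in `Φ`, and `u` has mean `1` under the weight `exp (-u)`.
  refine ⟨K + 1 / √V, by positivity, fun n hn a => ?_⟩
  have hn0 : (0 : ℝ) < n := by exact_mod_cast hn
  have hs : 0 < √(n * V) := Real.sqrt_pos.2 (by positivity)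
  have hexp : IntegrableOn (fun u : ℝ => Real.exp (-u)) (Ioi 0) := integrableOn_exp_neg_Ioi 0
  have hi : ∀ ω : Fin n → Ω, IntegrableOn (fun u => (∏ i, p (ω i)) *
      (Real.exp (-u) * (if ∑ i, f (ω i) ≤ a - u then 1 else 0))) (Ioi 0) := by
    intro ω
    refine Integrable.const_mul (hexp.mul_bdd (c := 1) ?_ (ae_of_all _ fun u => ?_)) _
    · exact (Measurable.ite (measurableSet_le measurable_const (by fun_prop))
        measurable_const measurable_const).aestronglyMeasurable
    · split_ifs <;> simp
  have h1 : ∑ ω : Fin n → Ω, (∏ i, p (ω i)) * max 0 (1 - Real.exp (∑ i, f (ω i) - a)) =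
      ∫ u in Ioi (0 : ℝ), Real.exp (-u) *
        ∑ ω : Fin n → Ω, (∏ i, p (ω i)) * (if ∑ i, f (ω i) ≤ a - u then 1 else 0) := by
    simp_rw [← integral_exp_neg_indicator, ← integral_const_mul]
    rw [← integral_finsetSum _ fun ω _ => hi ω]
    refine integral_congr_ae (ae_of_all _ fun u => ?_)
    simp only [Finset.mul_sum]
    exact Finset.sum_congr rfl fun ω _ => by ring
  set Φ₀ := stdNormalCDF ((a - n * C) / √(n * V)) with hΦ₀
  have h2 : ∀ u ∈ Ioi (0 : ℝ), (Φ₀ - K / √n) * Real.exp (-u) - 1 / √(n * V) * (Real.exp (-u) * u) ≤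
      Real.exp (-u) *
        ∑ ω : Fin n → Ω, (∏ i, p (ω i)) * (if ∑ i, f (ω i) ≤ a - u then 1 else 0) := by
    intro u hu
    have hu0 : 0 < u := hu
    have h3 := (abs_le.1 (h n hn (a - u))).1
    have h4 := stdNormalCDF_sub_le (x := (a - u - n * C) / √(n * V))
      (y := (a - n * C) / √(n * V)) (by gcongr; linarith)
    rw [← hΦ₀, show (a - n * C) / √(n * V) - (a - u - n * C) / √(n * V) = 1 / √(n * V) * u by
      ring] at h4
    calc _ = Real.exp (-u) * (Φ₀ - K / √n - 1 / √(n * V) * u) := by ring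
      _ ≤ _ := by gcongr; linarith
  have hl1 := hexp.const_mul (Φ₀ - K / √n)
  have hl2 := integrableOn_exp_neg_mul_self.const_mul (1 / √(n * V))
  have hsum : IntegrableOn (fun u => Real.exp (-u) *
      ∑ ω : Fin n → Ω, (∏ i, p (ω i)) * (if ∑ i, f (ω i) ≤ a - u then 1 else 0)) (Ioi 0) := by
    refine (integrable_finsetSum Finset.univ fun ω _ => hi ω).congr (ae_of_all _ fun u => ?_)
    simp only [Finset.mul_sum]
    exact Finset.sum_congr rfl fun ω _ => by ring
  have h5 := setIntegral_mono_on (hl1.sub hl2) hsum measurableSet_Ioi h2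
  rw [← h1] at h5
  simp only [Pi.sub_apply] at h5
  rw [integral_sub hl1 hl2, integral_const_mul, integral_const_mul, integral_exp_neg_mul_self,
    integral_exp_neg_Ioi_zero] at h5
  have h6 : 1 / √(n * V) = 1 / √V / √n := by
    rw [Real.sqrt_mul hn0.le]
    field_simp
  rw [h6] at h5
  rw [add_div]
  linarith

end Tail

/-! ### Relative entropy -/

lemma sub_le_mul_log_div {a b : ℝ} (ha : 0 ≤ a) (hb : 0 ≤ b) (hab : b = 0 → a = 0) :
    a - b ≤ a * Real.log (a / b) ∧ (a * Real.log (a / b) = a - b → a = b) := by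
  rcases ha.eq_or_lt with rfl | ha
  · simpa using ⟨hb, fun h => h.symm⟩
  have hb : 0 < b := hb.lt_of_ne fun h => ha.ne' (hab h.symm)
  have hlog : Real.log (a / b) = -Real.log (b / a) := by rw [← Real.log_inv, inv_div]
  have hba : a * (b / a - 1) = b - a := by field_simp
  refine ⟨?_, fun h => ?_⟩
  · have h1 := Real.log_le_sub_one_of_pos (div_pos hb ha)
    rw [hlog]
    nlinarith
  · by_contra hne
    have h1 := Real.log_lt_sub_one_of_pos (div_pos hb ha) fun h =>
      hne ((div_eq_one_iff_eq ha.ne').1 h).symm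
    rw [hlog] at h
    nlinarith

/-- Nonnegativity of the relative entropy, with the case of equality. -/
lemma sum_mul_log_div_nonneg {ι : Type*} [Fintype ι] {a b : ι → ℝ} (ha : ∀ i, 0 ≤ a i)
    (hb : ∀ i, 0 ≤ b i) (hab : ∀ i, b i = 0 → a i = 0) (hsum : ∑ i, a i = ∑ i, b i) :
    0 ≤ ∑ i, a i * Real.log (a i / b i) ∧ (∑ i, a i * Real.log (a i / b i) = 0 → a = b) := by
  have h0 : ∑ i, (a i - b i) = 0 := by rw [Finset.sum_sub_distrib, hsum, sub_self]
  have hle : ∀ i ∈ Finset.univ, a i - b i ≤ a i * Real.log (a i / b i) := fun i _ =>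
    (sub_le_mul_log_div (ha i) (hb i) (hab i)).1
  refine ⟨h0 ▸ Finset.sum_le_sum hle, fun h => ?_⟩
  have := (Finset.sum_eq_sum_iff_of_le hle).1 (h0.trans h.symm)
  ext i
  exact (sub_le_mul_log_div (ha i) (hb i) (hab i)).2 (this i (Finset.mem_univ i)).symm

/-! ### Capacity and dispersion of a singular symmetric channel -/

namespace Channel

open Finset

variable {X Y : Type*} [Fintype X] [Fintype Y] (W : Channel X Y)

open Classical in
/-- The number of inputs from which the output `y` can be reached. -/
noncomputable def degree (y : Y) : ℕ := #{x | 0 < W.prob x y}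

/-- For a singular channel, the information density at the output `y` under the uniform input
distribution; it does not depend on the input. -/
noncomputable def density (y : Y) : ℝ := Real.log (Fintype.card X / W.degree y)

/-- The output distribution induced by the uniform input distribution. -/
noncomputable def uniformOutput (y : Y) : ℝ := W.outputDist (fun _ => (Fintype.card X : ℝ)⁻¹) y

lemma uniformOutput_eq (y : Y) : W.uniformOutput y = (Fintype.card X : ℝ)⁻¹ * ∑ x, W.prob x y := by
  rw [uniformOutput, outputDist, mul_sum]

lemma uniformOutput_nonneg (y : Y) : 0 ≤ W.uniformOutput y := by
  rw [uniformOutput_eq]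
  exact mul_nonneg (by positivity) (sum_nonneg fun x _ => W.nonneg x y)

lemma outputDist_nonneg {P : X → ℝ} (hP : P ∈ stdSimplex ℝ X) (y : Y) : 0 ≤ W.outputDist P y :=
  sum_nonneg fun x _ => mul_nonneg (hP.1 x) (W.nonneg x y)

lemma sum_outputDist_mul (P : X → ℝ) (g : Y → ℝ) :
    ∑ y, W.outputDist P y * g y = ∑ x, P x * ∑ y, W.prob x y * g y := by
  simp_rw [outputDist, sum_mul, mul_sum]
  rw [sum_comm]
  simp_rw [mul_assoc]

lemma sum_outputDist {P : X → ℝ} (hP : P ∈ stdSimplex ℝ X) : ∑ y, W.outputDist P y = 1 := by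
  have := W.sum_outputDist_mul P fun _ => 1
  simpa [W.sum_eq_one, hP.2] using this

lemma uniform_mem_stdSimplex [Nonempty X] :
    (fun _ : X => (Fintype.card X : ℝ)⁻¹) ∈ stdSimplex ℝ X := by
  refine ⟨fun _ => by positivity, ?_⟩
  have : (Fintype.card X : ℝ) ≠ 0 := by simp
  simp [this]

lemma sum_uniformOutput [Nonempty X] : ∑ y, W.uniformOutput y = 1 :=
  W.sum_outputDist uniform_mem_stdSimplex

lemma uniformOutput_pos {x : X} {y : Y} (h : 0 < W.prob x y) : 0 < W.uniformOutput y := by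
  have : Nonempty X := ⟨x⟩
  rw [uniformOutput_eq]
  have h1 : 0 < ∑ x, W.prob x y :=
    h.trans_le (single_le_sum (fun x _ => W.nonneg x y) (mem_univ x))
  have h2 : (0 : ℝ) < Fintype.card X := by exact_mod_cast Fintype.card_pos
  positivity

lemma outputDist_eq_zero {P : X → ℝ} {y : Y} (h : W.uniformOutput y = 0) :
    W.outputDist P y = 0 := by
  refine sum_eq_zero fun x _ => ?_
  rcases (W.nonneg x y).eq_or_lt with h0 | h0
  · rw [← h0, mul_zero]
  · exact absurd h (W.uniformOutput_pos h0).ne'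

variable {W}

/-- All positive entries of the column coincide, so its sum is `degree y` times that common value.
-/
lemma IsSingular.prob_eq (hW : W.IsSingular) {x : X} {y : Y} (h : 0 < W.prob x y) :
    W.prob x y = W.uniformOutput y * Real.exp (W.density y) := by
  classical
  have h1 : ∑ z, W.prob z y = W.degree y * W.prob x y := by
    have h2 : ∀ z, W.prob z y = if 0 < W.prob z y then W.prob x y else 0 := by
      intro z
      split_ifs with hz
      · exact (hW x y z (mul_pos h hz)).symm
      · exact le_antisymm (not_lt.1 hz) (W.nonneg z y)
    rw [sum_congr rfl fun z _ => h2 z, ← sum_filter, sum_const, nsmul_eq_mul, degree]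
  have hd : 0 < W.degree y := card_pos.2 ⟨x, by simpa using h⟩
  have hd' : (0 : ℝ) < W.degree y := by exact_mod_cast hd
  have : Nonempty X := ⟨x⟩
  have hc : (0 : ℝ) < Fintype.card X := by exact_mod_cast Fintype.card_pos
  rw [density, Real.exp_log (by positivity), uniformOutput_eq, h1]
  field_simp

lemma IsSingular.prob_le (hW : W.IsSingular) (x : X) (y : Y) :
    W.prob x y ≤ W.uniformOutput y * Real.exp (W.density y) := by
  rcases (W.nonneg x y).eq_or_lt with h | h
  · rw [← h]
    exact mul_nonneg (W.uniformOutput_nonneg y) (Real.exp_nonneg _)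
  · exact (hW.prob_eq h).le

lemma IsSingular.log_div (hW : W.IsSingular) {x : X} {y : Y} (h : 0 < W.prob x y) :
    Real.log (W.prob x y / W.uniformOutput y) = W.density y := by
  have := (W.uniformOutput_pos h).ne'
  rw [hW.prob_eq h, mul_div_cancel_left₀ _ this, Real.log_exp]

/-- Within a part, permuted columns have equally many positive entries, so `density` is constant
there; permuted rows give the part equal total probability. -/
lemma IsSymmetric.sum_prob_mul_density (hW : W.IsSymmetric) (x x' : X) (g : ℝ → ℝ) :
    ∑ y, W.prob x y * g (W.density y) = ∑ y, W.prob x' y * g (W.density y) := by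
  classical
  obtain ⟨parts, hparts, hperm⟩ := hW
  choose part hpart huniq using hparts.2
  have hmem : ∀ S ∈ parts, ∀ y, part y = S ↔ y ∈ S := fun S hS y =>
    ⟨fun h => h ▸ (hpart y).2, fun h => (huniq y S ⟨hS, h⟩).symm⟩
  rw [← sum_fiberwise univ part, ← sum_fiberwise univ part fun y => W.prob x' y * _]
  refine sum_congr rfl fun S _ => ?_
  by_cases hS : S ∈ parts
  swap
  · have : ∀ y, part y ≠ S := fun y h => hS (h ▸ (hpart y).1)
    simp [this]
  obtain ⟨hrow, hcol⟩ := hperm S hS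
  have hdeg : ∀ y ∈ S, ∀ y' ∈ S, W.density y = W.density y' := by
    intro y hy y' hy'
    obtain ⟨τ, hτ⟩ := hcol y hy y' hy'
    rw [density, density, degree, degree]
    congr 3
    refine (card_bij (fun x _ => τ x) ?_ (fun _ _ _ _ h => τ.injective h) ?_).symm
    · intro x hx
      simpa [hτ] using hx
    · intro x hx
      exact ⟨τ.symm x, by simpa [hτ] using hx, by simp⟩
  have hfil : ∀ F : Y → ℝ, ∑ y with part y = S, F y = ∑ y : S, F y := by
    intro F
    refine (sum_subtype _ (fun y => ?_) F)
    simp [hmem S hS]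
  rw [hfil, hfil]
  obtain ⟨σ, hσ⟩ := hrow x x'
  rw [← Equiv.sum_comp σ]
  refine sum_congr rfl fun y _ => ?_
  rw [hσ y, hdeg (σ y) (σ y).2 y y.2]

lemma IsSymmetric.sum_outputDist_mul_density (hW : W.IsSymmetric) {P : X → ℝ}
    (hP : P ∈ stdSimplex ℝ X) (x : X) (g : ℝ → ℝ) :
    ∑ y, W.outputDist P y * g (W.density y) = ∑ y, W.prob x y * g (W.density y) := by
  rw [W.sum_outputDist_mul, sum_congr rfl fun z _ => by rw [hW.sum_prob_mul_density z x g],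
    ← sum_mul, hP.2, one_mul]

lemma IsSymmetric.sum_prob_mul_density_eq (hW : W.IsSymmetric) (x : X) (g : ℝ → ℝ) :
    ∑ y, W.prob x y * g (W.density y) = ∑ y, W.uniformOutput y * g (W.density y) :=
  have : Nonempty X := ⟨x⟩
  (hW.sum_outputDist_mul_density uniform_mem_stdSimplex x g).symm

variable (W) in
/-- The mean of the information density. -/
noncomputable def densityMean : ℝ := ∑ y, W.uniformOutput y * W.density y

variable (W) in
/-- The variance of the information density. -/
noncomputable def densityVariance : ℝ := ∑ y, W.uniformOutput y * (W.density y - W.densityMean) ^ 2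

/-- Splitting `log (W/q_P)` as `density - log (q_P/q)` leaves a first term whose mean does not
depend on `P`. What is subtracted is a relative entropy, so maximizers are exactly the inputs whose
output law is `q`. -/
lemma mutualInfo_eq [Nonempty X] (hsing : W.IsSingular) (hsymm : W.IsSymmetric) {P : X → ℝ}
    (hP : P ∈ stdSimplex ℝ X) : W.mutualInfo P = W.densityMean -
      ∑ y, W.outputDist P y * Real.log (W.outputDist P y / W.uniformOutput y) := by
  have h1 : ∀ x y, P x * W.prob x y * Real.log (W.prob x y / W.outputDist P y) =
      P x * (W.prob x y * W.density y) -
      P x * (W.prob x y * Real.log (W.outputDist P y / W.uniformOutput y)) := by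
    intro x y
    rcases (W.nonneg x y).eq_or_lt with h | h
    · simp [← h]
    rcases (hP.1 x).eq_or_lt with hx | hx
    · simp [← hx]
    have hq := W.uniformOutput_pos h
    have hqP : 0 < W.outputDist P y := (mul_pos hx h).trans_le
      (single_le_sum (f := fun x => P x * W.prob x y)
        (fun x _ => mul_nonneg (hP.1 x) (W.nonneg x y)) (mem_univ x))
    rw [← hsing.log_div h, Real.log_div h.ne' hqP.ne', Real.log_div h.ne' hq.ne',
      Real.log_div hqP.ne' hq.ne']
    ring
  obtain ⟨x⟩ := ‹Nonempty X›
  simp_rw [mutualInfo, h1, sum_sub_distrib, ← mul_sum]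
  rw [← W.sum_outputDist_mul, ← W.sum_outputDist_mul,
    hsymm.sum_outputDist_mul_density hP x fun z => z, hsymm.sum_prob_mul_density_eq x fun z => z,
    densityMean]

lemma mutualInfo_le [Nonempty X] (hsing : W.IsSingular) (hsymm : W.IsSymmetric) {P : X → ℝ}
    (hP : P ∈ stdSimplex ℝ X) : W.mutualInfo P ≤ W.densityMean ∧
      (W.mutualInfo P = W.densityMean → W.outputDist P = W.uniformOutput) := by
  have h := sum_mul_log_div_nonneg (W.outputDist_nonneg hP) W.uniformOutput_nonneg
    (fun y => W.outputDist_eq_zero) ((W.sum_outputDist hP).trans W.sum_uniformOutput.symm)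
  rw [mutualInfo_eq hsing hsymm hP]
  exact ⟨by linarith [h.1], fun h0 => h.2 (by linarith)⟩

lemma mutualInfo_uniform [Nonempty X] (hsing : W.IsSingular) (hsymm : W.IsSymmetric) :
    W.mutualInfo (fun _ => (Fintype.card X : ℝ)⁻¹) = W.densityMean := by
  rw [mutualInfo_eq hsing hsymm uniform_mem_stdSimplex]
  have : ∀ y, Real.log (W.outputDist (fun _ => (Fintype.card X : ℝ)⁻¹) y / W.uniformOutput y) = 0 :=
    fun y => by
      rw [← uniformOutput]
      rcases eq_or_ne (W.uniformOutput y) 0 with h | h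
      · simp [h]
      · rw [div_self h, Real.log_one]
  simp [this]

lemma capacity_eq [Nonempty X] (hsing : W.IsSingular) (hsymm : W.IsSymmetric) :
    W.capacity = W.densityMean := by
  refine IsGreatest.csSup_eq ⟨⟨_, uniform_mem_stdSimplex, mutualInfo_uniform hsing hsymm⟩, ?_⟩
  rintro _ ⟨P, hP, rfl⟩
  exact (mutualInfo_le hsing hsymm hP).1

/-- A capacity-achieving `P` need not be uniform, but its output law is, and only that law enters.
Hence the minimum and the maximum in the dispersion agree. -/
lemma condVariance_eq [Nonempty X] (hsing : W.IsSingular) (hsymm : W.IsSymmetric) {P : X → ℝ}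
    (hP : P ∈ W.capacityAchieving) : W.condVariance P = W.densityVariance := by
  have hq : W.outputDist P = W.uniformOutput :=
    (mutualInfo_le hsing hsymm hP.1).2 (hP.2.trans (capacity_eq hsing hsymm))
  have h1 : ∀ x, ∑ b, W.prob x b * Real.log (W.prob x b / W.outputDist P b) = W.densityMean := by
    intro x
    rw [densityMean, ← hsymm.sum_prob_mul_density_eq x fun z => z]
    refine sum_congr rfl fun b _ => ?_
    rcases (W.nonneg x b).eq_or_lt with h | h
    · simp [← h]
    · rw [hq, hsing.log_div h]
  have h2 : ∀ x y, P x * W.prob x y *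
      (Real.log (W.prob x y / W.outputDist P y) - W.densityMean) ^ 2 =
      P x * (W.prob x y * (W.density y - W.densityMean) ^ 2) := by
    intro x y
    rcases (W.nonneg x y).eq_or_lt with h | h
    · simp [← h]
    · rw [hq, hsing.log_div h, mul_assoc]
  simp_rw [condVariance, h1, h2, ← mul_sum]
  rw [← W.sum_outputDist_mul, hq, densityVariance]

lemma dispersion_eq [Nonempty X] (hsing : W.IsSingular) (hsymm : W.IsSymmetric) (ε : ℝ) :
    W.dispersion ε = W.densityVariance := by
  have hne : W.capacityAchieving.Nonempty :=
    ⟨_, uniform_mem_stdSimplex, (mutualInfo_uniform hsing hsymm).trans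
      (capacity_eq hsing hsymm).symm⟩
  have : W.condVariance '' W.capacityAchieving = {W.densityVariance} :=
    Set.eq_singleton_iff_nonempty_unique_mem.2 ⟨hne.image _, by
      rintro _ ⟨P, hP, rfl⟩
      exact condVariance_eq hsing hsymm hP⟩
  simp [dispersion, this]

lemma dispersion_of_isEmpty [IsEmpty X] (W : Channel X Y) (ε : ℝ) : W.dispersion ε = 0 := by
  have : W.capacityAchieving = ∅ := by
    refine Set.eq_empty_of_forall_notMem fun P hP => ?_
    have := hP.1.2
    simp at this
  simp [dispersion, this]

/-! ### Converse bound for block codes -/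

omit [Fintype X] in
lemma blockProb_nonneg (W : Channel X Y) {n : ℕ} (x : Fin n → X) (y : Fin n → Y) :
    0 ≤ W.blockProb x y :=
  prod_nonneg fun _ _ => W.nonneg _ _

lemma IsSingular.blockProb_le (hW : W.IsSingular) {n : ℕ} (x : Fin n → X) (y : Fin n → Y) :
    W.blockProb x y ≤ (∏ i, W.uniformOutput (y i)) * Real.exp (∑ i, W.density (y i)) := by
  rw [Real.exp_sum, ← prod_mul_distrib]
  exact prod_le_prod (fun _ _ => W.nonneg _ _) fun _ _ => hW.prob_le _ _

lemma IsSymmetric.sum_blockProb_mul (hW : W.IsSymmetric) {n : ℕ} (x : Fin n → X) (g : ℝ → ℝ) :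
    ∑ y, W.blockProb x y * g (∑ i, W.density (y i)) =
      ∑ y : Fin n → Y, (∏ i, W.uniformOutput (y i)) * g (∑ i, W.density (y i)) := by
  -- The test function must vary, since peeling off the first letter shifts its argument by that
  -- letter's density.
  induction n generalizing g with
  | zero => simp [blockProb]
  | succ n ih =>
    rw [← (Fin.consEquiv fun _ => Y).sum_comp, ← (Fin.consEquiv fun _ => Y).sum_comp,
      Fintype.sum_prod_type, Fintype.sum_prod_type]
    simp only [blockProb, Fin.consEquiv_apply, Fin.prod_univ_succ, Fin.sum_univ_succ,
      Fin.cons_zero, Fin.cons_succ, mul_assoc, ← mul_sum] at ih ⊢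
    refine (sum_congr rfl fun y₀ _ => congrArg _
      (ih (fun i => x i.succ) fun s => g (W.density y₀ + s))).trans ?_
    exact hW.sum_prob_mul_density_eq (x 0) fun z =>
      ∑ y : Fin n → Y, (∏ i, W.uniformOutput (y i)) * g (z + ∑ i, W.density (y i))

/-- A lower bound on the error probability of every code with `M` messages over a singular symmetric
channel. -/
theorem sum_uniformOutput_le_avgError (hsing : W.IsSingular) (hsymm : W.IsSymmetric) {n M : ℕ}
    (hM : 0 < M) (c : Code X Y n M) :
    ∑ y : Fin n → Y, (∏ i, W.uniformOutput (y i)) *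
      max 0 (1 - Real.exp (∑ i, W.density (y i) - Real.log M)) ≤ W.avgError c := by
  classical
  have hM0 : (0 : ℝ) < M := by exact_mod_cast hM
  set a := Real.log M
  set q : (Fin n → Y) → ℝ := fun y => ∏ i, W.uniformOutput (y i) with hq
  set z : (Fin n → Y) → ℝ := fun y => ∑ i, W.density (y i) with hz
  -- The indicator of the event where `1 - exp (z - a)` is positive turns the maximum into a
  -- difference of two terms.
  set g : ℝ → ℝ := fun s => if s < a then 1 else 0 with hg
  have h1 : ∀ y, q y * max 0 (1 - Real.exp (z y - a)) =
      q y * g (z y) - g (z y) * (q y * Real.exp (z y)) / M := by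
    intro y
    simp only [hg]
    split_ifs with h
    · have h2 : Real.exp (z y - a) = Real.exp (z y) / M := by rw [Real.exp_sub, Real.exp_log hM0]
      rw [max_eq_right (by linarith [Real.exp_le_one_iff.2 (by linarith : z y - a ≤ 0)]), h2]
      ring
    · rw [max_eq_left (by linarith [Real.one_le_exp (by linarith : 0 ≤ z y - a)])]
      ring
  -- Equality of the laws of `z` replaces `qⁿ` by the average over codewords; both sides can then be
  -- compared at each output separately.
  have h3 : ∑ y, q y * g (z y) = (1 / (M : ℝ)) * ∑ y, ∑ m, W.blockProb (c.encoder m) y * g (z y) := by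
    rw [sum_comm, sum_congr rfl fun m _ => hsymm.sum_blockProb_mul (c.encoder m) g]
    simp only [sum_const, card_univ, Fintype.card_fin, nsmul_eq_mul]
    rw [← mul_assoc, one_div, inv_mul_cancel₀ hM0.ne', one_mul]
  rw [sum_congr rfl fun y _ => h1 y, sum_sub_distrib, h3, avgError,
    sum_comm (s := univ (α := Fin M)),
    ← sum_div, div_eq_inv_mul (∑ _, _), ← one_div, ← mul_sub, ← sum_sub_distrib]
  gcongr with y
  have h4 : ∑ m, (if c.decoder y ≠ m then W.blockProb (c.encoder m) y else 0) =
      ∑ m, W.blockProb (c.encoder m) y - W.blockProb (c.encoder (c.decoder y)) y := by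
    rw [← add_sum_erase univ _ (mem_univ (c.decoder y)),
      ← add_sum_erase univ (fun m => W.blockProb (c.encoder m) y) (mem_univ (c.decoder y))]
    simp only [ne_eq, not_true_eq_false, if_false, zero_add, add_sub_cancel_left]
    refine sum_congr rfl fun m hm => if_pos (ne_of_mem_erase hm).symm
  -- At `y` only the decoded codeword's likelihood is not an error. It is at most `q exp z`, which
  -- settles `z < a`; elsewhere nonnegativity of the error suffices.
  have h5 := hsing.blockProb_le (c.encoder (c.decoder y)) y
  have h6 : W.blockProb (c.encoder (c.decoder y)) y ≤ ∑ m, W.blockProb (c.encoder m) y :=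
    single_le_sum (f := fun m => W.blockProb (c.encoder m) y)
      (fun m _ => W.blockProb_nonneg _ _) (mem_univ _)
  rw [h4, ← sum_mul]
  simp only [hg]
  split_ifs
  · simp only [hq, hz, mul_one, one_mul]
    linarith
  · linarith

end Channel

/-! ### Bounds on achievable sizes -/

namespace Channel

variable {X Y : Type*} [Fintype X] [Fintype Y] {W : Channel X Y}

omit [Fintype X] in
lemma avgError_nonneg (W : Channel X Y) {n M : ℕ} (c : Code X Y n M) : 0 ≤ W.avgError c := by
  classical
  refine mul_nonneg (by positivity) (Finset.sum_nonneg fun m _ => Finset.sum_nonneg fun y _ => ?_)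
  split_ifs
  · exact W.blockProb_nonneg _ _
  · exact le_rfl

lemma nonempty_code (X Y : Type*) [Nonempty X] (n : ℕ) {M : ℕ} (hM : 0 < M) :
    Nonempty (Code X Y n M) :=
  ⟨⟨fun _ _ => Classical.arbitrary X, fun _ => ⟨0, hM⟩⟩⟩

omit [Fintype X] in
lemma one_mem_achievableSizes [Nonempty X] (W : Channel X Y) (n : ℕ) {ε : ℝ} (hε : 0 ≤ ε) :
    1 ∈ W.achievableSizes n ε := by
  have h1 : ⌈Real.exp (n * 0)⌉₊ = 1 := by simp
  refine ⟨0, h1.symm, ?_⟩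
  obtain ⟨c⟩ := nonempty_code X Y n (M := ⌈Real.exp (n * 0)⌉₊) (by simp)
  refine (ciInf_le ⟨0, ?_⟩ c).trans (le_trans (le_of_eq ?_) hε)
  · rintro _ ⟨c, rfl⟩
    exact W.avgError_nonneg c
  · have : Subsingleton (Fin ⌈Real.exp (n * 0)⌉₊) := by rw [h1]; infer_instance
    simp [avgError, eq_iff_true_of_subsingleton]

lemma sum_uniformOutput_le_of_mem_achievableSizes [Nonempty X] (hsing : W.IsSingular)
    (hsymm : W.IsSymmetric) {n M : ℕ} {ε : ℝ} (h : M ∈ W.achievableSizes n ε) :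
    0 < M ∧ ∑ y : Fin n → Y, (∏ i, W.uniformOutput (y i)) *
      max 0 (1 - Real.exp (∑ i, W.density (y i) - Real.log M)) ≤ ε := by
  obtain ⟨R, rfl, hR⟩ := h
  have hM : 0 < ⌈Real.exp (n * R)⌉₊ := Nat.ceil_pos.2 (Real.exp_pos _)
  have := nonempty_code X Y n hM
  exact ⟨hM, (le_ciInf fun c => sum_uniformOutput_le_avgError hsing hsymm hM c).trans hR⟩

/-- Every sum of `n` values of `f` is at most `nZ`, so the whole average is at least `1 - exp (nZ -
a)`. This linear bound serves the blocklengths too small for the normal approximation. -/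
lemma log_le_of_sum_le {p f : Y → ℝ} (hp : ∀ y, 0 ≤ p y) (hp1 : ∑ y, p y = 1) {ε : ℝ} (hε : ε < 1)
    {n : ℕ} {a : ℝ} (h : ∑ y : Fin n → Y, (∏ i, p (y i)) *
      max 0 (1 - Real.exp (∑ i, f (y i) - a)) ≤ ε) :
    a ≤ n * (∑ y, |f y|) - Real.log (1 - ε) := by
  set Z := ∑ y, |f y|
  have h1 : 1 - Real.exp (n * Z - a) ≤ ε := by
    refine le_trans ?_ h
    calc 1 - Real.exp (n * Z - a)
        = ∑ y : Fin n → Y, (∏ i, p (y i)) * (1 - Real.exp (n * Z - a)) := by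
          rw [← Finset.sum_mul, sum_prod_eq_one hp1, one_mul]
      _ ≤ _ := by
          refine Finset.sum_le_sum fun y _ => ?_
          have h2 : ∑ i, f (y i) ≤ n * Z := by
            have := Finset.sum_le_card_nsmul Finset.univ (fun i => f (y i)) Z fun i _ =>
              (le_abs_self _).trans (Finset.single_le_sum (f := fun y => |f y|)
                (fun y _ => abs_nonneg _) (Finset.mem_univ (y i)))
            simpa using this
          refine mul_le_mul_of_nonneg_left (le_max_of_le_right ?_)
            (Finset.prod_nonneg fun i _ => hp _)
          gcongr
  have h3 : Real.log (1 - ε) ≤ n * Z - a := by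
    rw [Real.log_le_iff_le_exp (by linarith)]
    linarith
  linarith

/-- The second-order upper bound on the number of messages of a code over a singular symmetric
channel. -/
theorem exists_log_le_of_mem_achievableSizes [Nonempty X] (hsing : W.IsSingular)
    (hsymm : W.IsSymmetric) {ε : ℝ} (hε : ε ∈ Set.Ioo (0 : ℝ) 1) (hV : 0 < W.densityVariance) :
    ∃ K : ℝ, 0 < K ∧ ∀ n : ℕ, 1 ≤ n → ∀ M ∈ W.achievableSizes n ε, Real.log M ≤
      n * W.densityMean + √(n * W.densityVariance) * stdNormalQuantile ε + K := by
  set C := W.densityMean with hC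
  set V := W.densityVariance with hVdef
  set t₀ := stdNormalQuantile ε
  obtain ⟨K, hK, hclt⟩ := exists_stdNormalCDF_le_sum_exp W.uniformOutput_nonneg W.sum_uniformOutput
    hC.symm hVdef.symm hV
  obtain ⟨m, hm, hq⟩ := exists_le_stdNormalQuantile_add hε
  -- From `n = N` on, `K/√n ≤ m`, which is the range where the quantile can be inverted.
  set N : ℝ := (K / m) ^ 2
  set Z := ∑ y, |W.density y|
  have hlog : Real.log (1 - ε) < 0 := Real.log_neg (by linarith [hε.2]) (by linarith [hε.1])
  have hZ : 0 ≤ Z := Finset.sum_nonneg fun y _ => abs_nonneg _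
  have hK1 : 0 < √V * (K / m) := by positivity
  have hK2 : 0 < N * (Z + |C|) + √(N * V) * |t₀| - Real.log (1 - ε) := by
    have : 0 ≤ N * (Z + |C|) + √(N * V) * |t₀| := by positivity
    linarith
  refine ⟨√V * (K / m) + (N * (Z + |C|) + √(N * V) * |t₀| - Real.log (1 - ε)), by linarith,
    fun n hn M hM => ?_⟩
  have hn0 : (0 : ℝ) < n := by exact_mod_cast hn
  have hsn : 0 < √(n : ℝ) := Real.sqrt_pos.2 hn0
  obtain ⟨-, hsum⟩ := sum_uniformOutput_le_of_mem_achievableSizes hsing hsymm hM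
  rcases le_total (n : ℝ) N with hnN | hnN
  · have h1 := log_le_of_sum_le W.uniformOutput_nonneg W.sum_uniformOutput hε.2 hsum
    have h2 : n * Z ≤ N * Z := by gcongr
    have h3 : -(N * |C|) ≤ n * C := by
      have h4 : n * |C| ≤ N * |C| := by gcongr
      have h5 : n * -|C| ≤ n * C := by gcongr; exact neg_abs_le C
      linarith
    have h6 : -(√(N * V) * |t₀|) ≤ √(n * V) * t₀ := by
      have h4 : √(n * V) * |t₀| ≤ √(N * V) * |t₀| := by gcongr
      have h5 : √(n * V) * -|t₀| ≤ √(n * V) * t₀ := by gcongr; exact neg_abs_le t₀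
      linarith
    linarith
  · have h1 := hclt n hn (Real.log M)
    have h2 : K / √n ≤ m := by
      have h3 : K / m ≤ √n := Real.le_sqrt_of_sq_le hnN
      rw [div_le_iff₀ hm] at h3
      rw [div_le_iff₀ hsn]
      linarith
    have h4 := hq (K / √n) (by positivity) h2 _ (h1.trans (by linarith))
    have hs : 0 < √(n * V) := Real.sqrt_pos.2 (by positivity)
    rw [div_le_iff₀ hs] at h4
    have h5 : K / √n / m * √(n * V) = √V * (K / m) := by
      rw [Real.sqrt_mul hn0.le]
      field_simp
    linarith

end Channel

end DMC

/-- The first conjunct says that the maximum defining `M*(n,ε)` is attained. -/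
theorem proposition1 {X Y : Type*} [Fintype X] [Fintype Y] (W : DMC.Channel X Y)
    (hsing : W.IsSingular) (hsymm : W.IsSymmetric)
    (ε : ℝ) (hε : ε ∈ Set.Ioo (0 : ℝ) 1) (hV : 0 < W.dispersion ε) :
    ∃ K : ℝ, 0 < K ∧ ∀ n : ℕ, 1 ≤ n →
      IsGreatest (W.achievableSizes n ε) (W.maxSize n ε) ∧
      Real.log (W.maxSize n ε) ≤
        n * W.capacity + Real.sqrt (n * W.dispersion ε) * DMC.stdNormalQuantile ε + K := by
  have : Nonempty X := by
    by_contra h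
    rw [not_nonempty_iff] at h
    exact hV.ne' (DMC.Channel.dispersion_of_isEmpty W ε)
  rw [DMC.Channel.dispersion_eq hsing hsymm] at hV ⊢
  rw [DMC.Channel.capacity_eq hsing hsymm]
  obtain ⟨K, hK, h⟩ := DMC.Channel.exists_log_le_of_mem_achievableSizes hsing hsymm hε hV
  refine ⟨K, hK, fun n hn => ?_⟩
  -- The converse itself bounds the set of sizes; being a nonempty set of naturals, it then contains
  -- its supremum.
  have hbdd : BddAbove (W.achievableSizes n ε) := by
    refine ⟨⌈Real.exp (n * W.densityMean + √(n * W.densityVariance) * DMC.stdNormalQuantile ε + K)⌉₊,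
      fun M hM => ?_⟩
    have hM0 : (0 : ℝ) < M := by
      exact_mod_cast (DMC.Channel.sum_uniformOutput_le_of_mem_achievableSizes hsing hsymm hM).1
    have h1 := (Real.log_le_iff_le_exp hM0).1 (h n hn M hM)
    exact_mod_cast h1.trans (Nat.le_ceil _)
  have hmem : W.maxSize n ε ∈ W.achievableSizes n ε :=
    Nat.sSup_mem ⟨1, DMC.Channel.one_mem_achievableSizes W n hε.1.le⟩ hbdd
  exact ⟨⟨hmem, fun M hM => le_csSup hbdd hM⟩, h n hn _ hmem⟩
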